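/- \textbf{Setting.} Let $\partial\mathbf D$ be the unit circle with counterclockwise orientation and arc length measure. A continuous function $F:\mathbf R\to\mathbf C$ is \emph{almost periodic} if for every $\epsilon>0$ there is $l>0$ such that every interval $[t_0,t_0+l]$ contains a $\tau$ with $|F(t)-F(t+\tau)|<\epsilon$ for all $t\in\mathbf R$; let $AP(\mathbf R)$ be the uniform algebra of these functions. For $t_0\in\mathbf R$, $k\in\{-1,1\}$ and $s\in(0,\pi)$ put $\gamma_{t_0^k}(s)=\{e^{i(t_0+kt)}:0<t<s\}$. A continuous function $f_k$ on $\gamma_{t_0^k}(s)$ is almost periodic if $t\mapsto f_k(e^{i(t_0+kse^{t})})$, $t<0$, is the restriction of an almost periodic function on $\mathbf R$. Let $AP(\partial\mathbf D)\subset L^\infty(\partial\mathbf D)$ consist of all $f$ such that for every $t_0$ and $\epsilon>0$ there are $s\in(0,\pi)$ and almost periodic functions $f_k$ on $\gamma_{t_0^k}(s)$, $k=\pm1$, with $\operatorname{ess\,sup}_{\gamma_{t_0^k}(s)}|f-f_k|<\epsilon$ for both $k$. Let $S\subset\partial\mathbf D$ be nonempty and closed. Let $AP(S)$ be the algebra of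 all $f\in AP(\partial\mathbf D)$ that are continuous on $\partial\mathbf D\setminus S$, and $R_S\subset AP(S)$ the algebra of all $f\in L^\infty(\partial\mathbf D)$ that are continuous on $\partial\mathbf D\setminus S$ and have both one-sided limits (equal or not) at every point of $S$ (for elements of $L^\infty$, continuity and one-sided limits are those of suitable representatives). For a commutative unital Banach algebra $A$ let $\mathcal M(A)$ be its maximal ideal space, i.e. the space of nonzero homomorphisms $A\to\mathbf C$ with the weak$^*$ topology. The embeddings $C(\partial\mathbf D)\hookrightarrow R_S\hookrightarrow AP(S)$ induce, by duality, continuous maps $$\mathcal M(AP(S))\xrightarrow{\ r_S\ }\mathcal M(R_S)\xrightarrow{\ c_S\ }\mathcal M(C(\partial\mathbf D))\cong\partial\mathbf D .$$ Let $b\mathbf R$ be the Bohr compactification of $\mathbf R$, regarded as the topological space $\mathcal M(AP(\mathbf R))$. \textbf{Theorem.} \begin{enumerate} \item[(1)] For every $z=e^{it_0}\in S$ the preimage $c_S^{-1}(z)$ consists of exactly two points $z_+\neq z_-$, which correspond to the counterclockwise and the clockwise orientation at $z$: for every $f\in R_S$, $z_+(f)=\lim_{t\to0+}f(e^{i(t_0+t)})$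 and $z_-(f)=\lim_{t\to0+}f(e^{i(t_0-t)})$. \item[(2)] $c_S:\mathcal M(R_S)\setminus c_S^{-1}(S)\to\partial\mathbf D\setminus S$ is a homeomorphism. \item[(3)] $c_S^{-1}(S)\subset\mathcal M(R_S)$ is a totally disconnected compact Hausdorff space. \item[(4)] For every $\xi\in c_S^{-1}(S)$ the preimage $r_S^{-1}(\xi)$ is homeomorphic to $b\mathbf R$. \item[(5)] $r_S:\mathcal M(AP(S))\setminus(c_S\circ r_S)^{-1}(S)\to\mathcal M(R_S)\setminus c_S^{-1}(S)$ is a homeomorphism (hence, by (2), its source is homeomorphic to $\partial\mathbf D\setminus S$). \end{enumerate} -/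

import Mathlib

open MeasureTheory Set Filter Topology
open scoped ENNReal BoundedContinuousFunction

noncomputable section

/-! ### Almost periodic functions on the real line -/

/-- Almost periodic functions on `ℝ` in the sense of Bohr. -/
def IsAlmostPeriodic (f : ℝ → ℂ) : Prop :=
  Continuous f ∧ ∀ ε : ℝ, 0 < ε → ∃ l : ℝ, 0 < l ∧ ∀ t₀ : ℝ, ∃ τ ∈ Icc t₀ (t₀ + l),
    ∀ t : ℝ, ‖f t - f (t + τ)‖ < ε

namespace IsAlmostPeriodic

theorem const (c : ℂ) : IsAlmostPeriodic (fun _ => c) :=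
  ⟨continuous_const, fun ε hε => ⟨1, one_pos, fun t₀ => ⟨t₀, by simp, by simpa using hε⟩⟩⟩

theorem comp_add_const {f : ℝ → ℂ} (hf : IsAlmostPeriodic f) (a : ℝ) :
    IsAlmostPeriodic (fun t => f (t + a)) := by
  refine ⟨hf.1.comp (continuous_id.add continuous_const), fun ε hε => ?_⟩
  obtain ⟨l, hl, h⟩ := hf.2 ε hε
  refine ⟨l, hl, fun t₀ => ?_⟩
  obtain ⟨τ, hτ, h⟩ := h t₀
  refine ⟨τ, hτ, fun t => ?_⟩
  have := h (t + a)
  rwa [show t + a + τ = t + τ + a by ring] at this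

theorem bounded {f : ℝ → ℂ} (hf : IsAlmostPeriodic f) : ∃ C : ℝ, 0 < C ∧ ∀ t, ‖f t‖ ≤ C := by
  obtain ⟨l, hl, h⟩ := hf.2 1 one_pos
  obtain ⟨C, hC⟩ := (isCompact_Icc (a := (0 : ℝ)) (b := l)).exists_bound_of_continuousOn
    hf.1.continuousOn
  refine ⟨|C| + 1, by positivity, fun t => ?_⟩
  obtain ⟨τ, hτ, h⟩ := h (-t)
  have h1 := hC (t + τ) ⟨by linarith [hτ.1], by linarith [hτ.2]⟩
  have h2 := h t
  have h3 := norm_sub_norm_le (f t) (f (t + τ))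
  linarith [le_abs_self C]

theorem uniformly_close {f : ℝ → ℂ} (hf : IsAlmostPeriodic f) {ε : ℝ} (hε : 0 < ε) :
    ∃ δ : ℝ, 0 < δ ∧ ∀ s t : ℝ, |s - t| < δ → ‖f s - f t‖ < ε := by
  obtain ⟨l, hl, h⟩ := hf.2 (ε / 3) (by positivity)
  have huc := (isCompact_Icc (a := (-1 : ℝ)) (b := l + 1)).uniformContinuousOn_of_continuous
    hf.1.continuousOn
  obtain ⟨δ, hδ, hu⟩ := Metric.uniformContinuousOn_iff.1 huc (ε / 3) (by positivity)
  refine ⟨min δ 1, by positivity, fun s t hst => ?_⟩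
  obtain ⟨τ, hτ, h⟩ := h (-s)
  have hst1 := abs_lt.1 (hst.trans_le (min_le_right _ _))
  have h1 := hu (s + τ) ⟨by linarith [hτ.1], by linarith [hτ.2]⟩
    (t + τ) ⟨by linarith [hτ.1], by linarith [hτ.2]⟩
    (by rw [Real.dist_eq, add_sub_add_right_eq_sub]; exact hst.trans_le (min_le_left _ _))
  rw [dist_eq_norm] at h1
  have h2 := h s
  have h3 := h t
  rw [norm_sub_rev] at h3
  have h4 := norm_add₃_le (a := f s - f (s + τ)) (b := f (s + τ) - f (t + τ))
    (c := f (t + τ) - f t)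
  rw [show f s - f (s + τ) + (f (s + τ) - f (t + τ)) + (f (t + τ) - f t) = f s - f t by ring] at h4
  linarith

/-- Two almost periodic functions have a relatively dense set of common almost periods. -/
theorem common_period {f g : ℝ → ℂ} (hf : IsAlmostPeriodic f) (hg : IsAlmostPeriodic g)
    {ε : ℝ} (hε : 0 < ε) : ∃ l : ℝ, 0 < l ∧ ∀ t₀ : ℝ, ∃ τ ∈ Icc t₀ (t₀ + l),
      (∀ t : ℝ, ‖f t - f (t + τ)‖ < ε) ∧ ∀ t : ℝ, ‖g t - g (t + τ)‖ < ε := by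
  obtain ⟨l₁, hl₁, hf'⟩ := hf.2 (ε / 3) (by positivity)
  obtain ⟨l₂, hl₂, hg'⟩ := hg.2 (ε / 3) (by positivity)
  obtain ⟨δ, hδ, hu⟩ := hg.uniformly_close (ε := ε / 3) (by positivity)
  choose τ hτ hfτ using hf'
  choose σ hσ hgσ using hg'
  set D : Set ℝ := range fun a => τ a - σ a with hD
  have hDb : TotallyBounded D := by
    refine (isCompact_Icc (a := -l₂) (b := l₁)).totallyBounded.subset ?_
    rintro _ ⟨a, rfl⟩
    exact ⟨by linarith [(hτ a).1, (hσ a).2], by linarith [(hτ a).2, (hσ a).1]⟩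
  obtain ⟨F, hFD, hF, hcov⟩ := totallyBounded_iff_subset.1 hDb _ (Metric.dist_mem_uniformity hδ)
  have hFi : ∀ y ∈ F, ∃ a, τ a - σ a = y := fun y hy => hFD hy
  choose! α hα using hFi
  obtain ⟨M, hM⟩ := (hF.image fun y => |τ (α y)|).bddAbove
  have hM0 : ∀ y ∈ F, |τ (α y)| ≤ |M| := fun y hy =>
    (hM (mem_image_of_mem _ hy)).trans (le_abs_self M)
  refine ⟨2 * |M| + l₁, by positivity, fun t₀ => ?_⟩
  have hmem : τ (t₀ + |M|) - σ (t₀ + |M|) ∈ D := ⟨_, rfl⟩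
  obtain ⟨y, hy, hdist⟩ := mem_iUnion₂.1 (hcov hmem)
  have hdist' : |τ (t₀ + |M|) - σ (t₀ + |M|) - y| < δ := hdist
  have hyM := abs_le.1 (hM0 y hy)
  have hτ' := hτ (t₀ + |M|)
  set a := t₀ + |M| with ha
  refine ⟨τ a - τ (α y), ⟨by linarith [hτ'.1], by linarith [hτ'.2]⟩, fun t => ?_, fun t => ?_⟩
  · have h1 := hfτ a (t - τ (α y))
    have h2 := hfτ (α y) (t - τ (α y))
    rw [sub_add_cancel] at h2
    rw [norm_sub_rev] at h2
    have h3 := norm_add_le (f t - f (t - τ (α y))) (f (t - τ (α y)) - f (t - τ (α y) + τ a))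
    rw [sub_add_sub_cancel] at h3
    rw [show t + (τ a - τ (α y)) = t - τ (α y) + τ a by ring]
    linarith
  · have h1 := hgσ a (t - σ (α y))
    have h2 := hgσ (α y) (t - σ (α y))
    rw [sub_add_cancel, norm_sub_rev] at h2
    have h4 := hu (t - σ (α y) + σ a) (t + (τ a - τ (α y))) (by
      rw [← abs_neg]
      rw [← hα y hy] at hdist'
      convert hdist' using 2
      ring)
    have h3 := norm_add₃_le (a := g t - g (t - σ (α y)))
      (b := g (t - σ (α y)) - g (t - σ (α y) + σ a))
      (c := g (t - σ (α y) + σ a) - g (t + (τ a - τ (α y))))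
    rw [sub_add_sub_cancel, sub_add_sub_cancel] at h3
    linarith

theorem add {f g : ℝ → ℂ} (hf : IsAlmostPeriodic f) (hg : IsAlmostPeriodic g) :
    IsAlmostPeriodic (fun t => f t + g t) := by
  refine ⟨hf.1.add hg.1, fun ε hε => ?_⟩
  obtain ⟨l, hl, h⟩ := hf.common_period hg (ε := ε / 2) (by positivity)
  refine ⟨l, hl, fun t₀ => ?_⟩
  obtain ⟨τ, hτ, h1, h2⟩ := h t₀
  refine ⟨τ, hτ, fun t => ?_⟩
  rw [add_sub_add_comm]
  exact (norm_add_le _ _).trans_lt (by linarith [h1 t, h2 t])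

theorem mul {f g : ℝ → ℂ} (hf : IsAlmostPeriodic f) (hg : IsAlmostPeriodic g) :
    IsAlmostPeriodic (fun t => f t * g t) := by
  refine ⟨hf.1.mul hg.1, fun ε hε => ?_⟩
  obtain ⟨A, hA, hfA⟩ := hf.bounded
  obtain ⟨B, hB, hgB⟩ := hg.bounded
  obtain ⟨l, hl, h⟩ := hf.common_period hg (ε := ε / (A + B)) (by positivity)
  refine ⟨l, hl, fun t₀ => ?_⟩
  obtain ⟨τ, hτ, h1, h2⟩ := h t₀
  refine ⟨τ, hτ, fun t => ?_⟩
  rw [show f t * g t - f (t + τ) * g (t + τ)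
    = f t * (g t - g (t + τ)) + (f t - f (t + τ)) * g (t + τ) by ring]
  refine (norm_add_le _ _).trans_lt ?_
  rw [norm_mul, norm_mul]
  have e1 : ‖f t‖ * ‖g t - g (t + τ)‖ ≤ A * ‖g t - g (t + τ)‖ := by gcongr; exact hfA t
  have e2 : ‖f t - f (t + τ)‖ * ‖g (t + τ)‖ ≤ ‖f t - f (t + τ)‖ * B := by gcongr; exact hgB _
  have e3 : A * ‖g t - g (t + τ)‖ < A * (ε / (A + B)) := by gcongr; exact h2 t
  have e4 : ‖f t - f (t + τ)‖ * B < ε / (A + B) * B := by gcongr; exact h1 t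
  have e5 : A * (ε / (A + B)) + ε / (A + B) * B = ε := by field_simp
  linarith

end IsAlmostPeriodic

/-- The uniform algebra of almost periodic functions on `ℝ` (they are all bounded). -/
def APReal : Subalgebra ℂ (ℝ →ᵇ ℂ) where
  carrier := {f | IsAlmostPeriodic f}
  mul_mem' hf hg := hf.mul hg
  add_mem' hf hg := hf.add hg
  algebraMap_mem' c := IsAlmostPeriodic.const c

/-- The Bohr compactification `bℝ` of the real line, realized as the maximal ideal space of the
algebra of almost periodic functions on `ℝ`. -/
abbrev BohrCompactification : Type := WeakDual.characterSpace ℂ APReal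

/-! ### The algebra `L^∞` of the unit circle -/

instance Circle.instMeasurableSpaceBorel : MeasurableSpace Circle := borel Circle

instance Circle.instBorelSpace : BorelSpace Circle := ⟨rfl⟩

/-- Arc length on the unit circle. -/
def arcLength : Measure Circle :=
  (volume.restrict (Ioc (-Real.pi) Real.pi)).map Circle.exp

instance arcLength.instIsFiniteMeasure : IsFiniteMeasure arcLength := by
  unfold arcLength; infer_instance

/-- The space `L^∞` of the unit circle, with the essential supremum norm. -/
abbrev LInfty : Type := Lp ℂ ∞ arcLength

namespace LInfty

instance instMul : Mul LInfty where
  mul f g := ⟨(f : Circle →ₘ[arcLength] ℂ) * (g : Circle →ₘ[arcLength] ℂ), by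
    rw [Lp.mem_Lp_iff_memLp]
    exact (memLp_congr_ae (AEEqFun.coeFn_mul _ _)).2
      (MemLp.mul (p := ∞) (q := ∞) (Lp.memLp g) (Lp.memLp f))⟩

instance instOne : One LInfty where
  one := ⟨1, by
    rw [Lp.mem_Lp_iff_memLp]
    exact (memLp_congr_ae AEEqFun.coeFn_one).2 (memLp_const (1 : ℂ))⟩

theorem coe_mul (f g : LInfty) : ((f * g : LInfty) : Circle →ₘ[arcLength] ℂ) = f * g := rfl

theorem coe_one : ((1 : LInfty) : Circle →ₘ[arcLength] ℂ) = 1 := rfl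

theorem coeFn_mul (f g : LInfty) : ⇑(f * g) =ᵐ[arcLength] fun z => f z * g z :=
  AEEqFun.coeFn_mul _ _

theorem coeFn_one : ⇑(1 : LInfty) =ᵐ[arcLength] fun _ => 1 :=
  AEEqFun.coeFn_one

theorem ae_norm_le (f : LInfty) : ∀ᵐ z ∂arcLength, ‖f z‖ ≤ ‖f‖ := by
  have h := ae_le_eLpNormEssSup (f := f) (μ := arcLength)
  filter_upwards [h] with z hz
  rw [← eLpNorm_exponent_top] at hz
  rw [Lp.norm_def]
  have := ENNReal.toReal_mono (Lp.eLpNorm_ne_top f) hz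
  simpa using this

theorem mul_norm_le (f g : LInfty) : ‖f * g‖ ≤ ‖f‖ * ‖g‖ := by
  rw [Lp.norm_def, eLpNorm_exponent_top]
  refine ENNReal.toReal_le_of_le_ofReal (by positivity) ?_
  refine eLpNormEssSup_le_of_ae_bound ?_
  filter_upwards [coeFn_mul f g, ae_norm_le f, ae_norm_le g] with z h1 h2 h3
  rw [h1, norm_mul]
  gcongr

/-- Pointwise multiplication makes `L^∞` a commutative Banach algebra. -/
instance instNormedCommRing : NormedCommRing LInfty :=
  { (inferInstance : NormedAddCommGroup LInfty), instMul, instOne with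
    left_distrib := fun f g h => by
      refine Lp.ext ?_
      filter_upwards [coeFn_mul f (g + h), Lp.coeFn_add g h, coeFn_mul f g, coeFn_mul f h,
        Lp.coeFn_add (f * g) (f * h)] with z h1 h2 h3 h4 h5
      rw [h1, h2, h5, Pi.add_apply, Pi.add_apply, h3, h4, mul_add]
    right_distrib := fun f g h => by
      refine Lp.ext ?_
      filter_upwards [coeFn_mul (f + g) h, Lp.coeFn_add f g, coeFn_mul f h, coeFn_mul g h,
        Lp.coeFn_add (f * h) (g * h)] with z h1 h2 h3 h4 h5
      rw [h1, h2, h5, Pi.add_apply, Pi.add_apply, h3, h4, add_mul]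
    zero_mul := fun f => by
      refine Lp.ext ?_
      filter_upwards [coeFn_mul 0 f, Lp.coeFn_zero ℂ ∞ arcLength] with z h1 h2
      rw [h1, h2, Pi.zero_apply, zero_mul]
    mul_zero := fun f => by
      refine Lp.ext ?_
      filter_upwards [coeFn_mul f 0, Lp.coeFn_zero ℂ ∞ arcLength] with z h1 h2
      rw [h1, h2, Pi.zero_apply, mul_zero]
    mul_assoc := fun f g h => Subtype.ext (mul_assoc (f : Circle →ₘ[arcLength] ℂ) g h)
    one_mul := fun f => Subtype.ext (one_mul (f : Circle →ₘ[arcLength] ℂ))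
    mul_one := fun f => Subtype.ext (mul_one (f : Circle →ₘ[arcLength] ℂ))
    mul_comm := fun f g => Subtype.ext (mul_comm (f : Circle →ₘ[arcLength] ℂ) g)
    norm_mul_le := mul_norm_le }

instance instAlgebra : Algebra ℂ LInfty :=
  Algebra.ofModule
    (fun c f g => by
      refine Lp.ext ?_
      filter_upwards [coeFn_mul (c • f) g, Lp.coeFn_smul c f, coeFn_mul f g,
        Lp.coeFn_smul c (f * g)] with z h1 h2 h3 h4
      rw [h1, h2, h4, Pi.smul_apply, Pi.smul_apply, h3, smul_mul_assoc])
    (fun c f g => by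
      refine Lp.ext ?_
      filter_upwards [coeFn_mul f (c • g), Lp.coeFn_smul c g, coeFn_mul f g,
        Lp.coeFn_smul c (f * g)] with z h1 h2 h3 h4
      rw [h1, h2, h4, Pi.smul_apply, Pi.smul_apply, h3, mul_smul_comm])

instance instNormedAlgebra : NormedAlgebra ℂ LInfty where
  norm_smul_le := norm_smul_le

theorem coeFn_algebraMap (c : ℂ) : ⇑(algebraMap ℂ LInfty c) =ᵐ[arcLength] fun _ => c := by
  rw [Algebra.algebraMap_eq_smul_one]
  filter_upwards [Lp.coeFn_smul c (1 : LInfty), coeFn_one] with z h1 h2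
  rw [h1, Pi.smul_apply, h2, smul_eq_mul, mul_one]

end LInfty

/-! ### The algebras `AP(S)` and `R_S` -/

/-- The point `e^{i(t₀ + k t)}`. -/
def arcPoint (t₀ : ℝ) (k : ℤˣ) (t : ℝ) : Circle := Circle.exp (t₀ + ((k : ℤ) : ℝ) * t)

/-- The open arc of length `s` issuing from `e^{i t₀}`, counterclockwise for `k = 1` and clockwise
for `k = -1`. -/
def openArc (t₀ : ℝ) (k : ℤˣ) (s : ℝ) : Set Circle := arcPoint t₀ k '' Ioo 0 s

/-- Almost periodicity of a function on the open arc `openArc t₀ k s`; the values of `f` outside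
the arc are irrelevant. -/
def IsAlmostPeriodicOnArc (t₀ : ℝ) (k : ℤˣ) (s : ℝ) (f : Circle → ℂ) : Prop :=
  ContinuousOn f (openArc t₀ k s) ∧
    ∃ F : ℝ → ℂ, IsAlmostPeriodic F ∧ ∀ t : ℝ, t < 0 → f (arcPoint t₀ k (s * Real.exp t)) = F t

/-- The functions in `L^∞` that belong to `AP(∂𝔻)`. -/
def IsAlmostPeriodicOnCircle (f : LInfty) : Prop :=
  ∀ t₀ ε : ℝ, 0 < ε → ∃ s ∈ Ioo 0 Real.pi, ∀ k : ℤˣ, ∃ fk : Circle → ℂ,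
    IsAlmostPeriodicOnArc t₀ k s fk ∧
      essSup (fun z => ‖f z - fk z‖ₑ) (arcLength.restrict (openArc t₀ k s)) < ENNReal.ofReal ε

/-- `f` in `L^∞` is continuous on `U`, that is, it has a representative that is. -/
def HasContinuousRepOn (f : LInfty) (U : Set Circle) : Prop :=
  ∃ g : Circle → ℂ, f =ᵐ[arcLength] g ∧ ContinuousOn g U

/-- `f` in `L^∞` has the limit `L` at `e^{i t₀}` along the arcs that issue from this point
counterclockwise (`k = 1`) or clockwise (`k = -1`). -/
def HasOneSidedLimit (f : LInfty) (t₀ : ℝ) (k : ℤˣ) (L : ℂ) : Prop :=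
  ∃ g : Circle → ℂ, f =ᵐ[arcLength] g ∧ Tendsto (fun t => g (arcPoint t₀ k t)) (𝓝[>] 0) (𝓝 L)

theorem HasContinuousRepOn.add {f g : LInfty} {U : Set Circle} (hf : HasContinuousRepOn f U)
    (hg : HasContinuousRepOn g U) : HasContinuousRepOn (f + g) U := by
  obtain ⟨f', hf, hf'⟩ := hf
  obtain ⟨g', hg, hg'⟩ := hg
  exact ⟨f' + g', (Lp.coeFn_add f g).trans (hf.add hg), hf'.add hg'⟩

theorem HasContinuousRepOn.mul {f g : LInfty} {U : Set Circle} (hf : HasContinuousRepOn f U)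
    (hg : HasContinuousRepOn g U) : HasContinuousRepOn (f * g) U := by
  obtain ⟨f', hf, hf'⟩ := hf
  obtain ⟨g', hg, hg'⟩ := hg
  exact ⟨f' * g', (LInfty.coeFn_mul f g).trans (hf.mul hg), hf'.mul hg'⟩

theorem HasContinuousRepOn.algebraMap (c : ℂ) (U : Set Circle) :
    HasContinuousRepOn (algebraMap ℂ LInfty c) U :=
  ⟨fun _ => c, LInfty.coeFn_algebraMap c, continuousOn_const⟩

theorem HasOneSidedLimit.add {f g : LInfty} {t₀ : ℝ} {k : ℤˣ} {L M : ℂ}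
    (hf : HasOneSidedLimit f t₀ k L) (hg : HasOneSidedLimit g t₀ k M) :
    HasOneSidedLimit (f + g) t₀ k (L + M) := by
  obtain ⟨f', hf, hf'⟩ := hf
  obtain ⟨g', hg, hg'⟩ := hg
  exact ⟨f' + g', (Lp.coeFn_add f g).trans (hf.add hg), hf'.add hg'⟩

theorem HasOneSidedLimit.mul {f g : LInfty} {t₀ : ℝ} {k : ℤˣ} {L M : ℂ}
    (hf : HasOneSidedLimit f t₀ k L) (hg : HasOneSidedLimit g t₀ k M) :
    HasOneSidedLimit (f * g) t₀ k (L * M) := by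
  obtain ⟨f', hf, hf'⟩ := hf
  obtain ⟨g', hg, hg'⟩ := hg
  exact ⟨f' * g', (LInfty.coeFn_mul f g).trans (hf.mul hg), hf'.mul hg'⟩

theorem HasOneSidedLimit.algebraMap (c : ℂ) (t₀ : ℝ) (k : ℤˣ) :
    HasOneSidedLimit (algebraMap ℂ LInfty c) t₀ k c :=
  ⟨fun _ => c, LInfty.coeFn_algebraMap c, tendsto_const_nhds⟩

namespace IsAlmostPeriodicOnArc

theorem const (t₀ : ℝ) (k : ℤˣ) (s : ℝ) (c : ℂ) : IsAlmostPeriodicOnArc t₀ k s (fun _ => c) :=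
  ⟨continuousOn_const, fun _ => c, .const c, fun _ _ => rfl⟩

theorem add {t₀ : ℝ} {k : ℤˣ} {s : ℝ} {f g : Circle → ℂ} (hf : IsAlmostPeriodicOnArc t₀ k s f)
    (hg : IsAlmostPeriodicOnArc t₀ k s g) :
    IsAlmostPeriodicOnArc t₀ k s (fun z => f z + g z) := by
  obtain ⟨hf, F, hF, hfF⟩ := hf
  obtain ⟨hg, G, hG, hgG⟩ := hg
  exact ⟨hf.add hg, _, hF.add hG, fun t ht => by simp only [hfF t ht, hgG t ht]⟩

theorem mul {t₀ : ℝ} {k : ℤˣ} {s : ℝ} {f g : Circle → ℂ} (hf : IsAlmostPeriodicOnArc t₀ k s f)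
    (hg : IsAlmostPeriodicOnArc t₀ k s g) :
    IsAlmostPeriodicOnArc t₀ k s (fun z => f z * g z) := by
  obtain ⟨hf, F, hF, hfF⟩ := hf
  obtain ⟨hg, G, hG, hgG⟩ := hg
  exact ⟨hf.mul hg, _, hF.mul hG, fun t ht => by simp only [hfF t ht, hgG t ht]⟩

theorem mono {t₀ : ℝ} {k : ℤˣ} {s s' : ℝ} {f : Circle → ℂ} (hf : IsAlmostPeriodicOnArc t₀ k s f)
    (hs' : 0 < s') (hs : s' ≤ s) : IsAlmostPeriodicOnArc t₀ k s' f := by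
  obtain ⟨hf, F, hF, hfF⟩ := hf
  refine ⟨hf.mono (image_mono (Ioo_subset_Ioo_right hs)), _,
    hF.comp_add_const (Real.log (s' / s)), fun t ht => ?_⟩
  have hs0 : 0 < s := hs'.trans_le hs
  have hl : Real.log (s' / s) ≤ 0 := Real.log_nonpos (by positivity) ((div_le_one hs0).2 hs)
  rw [← hfF _ (by linarith), Real.exp_add, Real.exp_log (by positivity)]
  congr 2
  field_simp

end IsAlmostPeriodicOnArc

/-- Ess sup inequalities in terms of almost every point. -/
theorem isAlmostPeriodicOnCircle_iff (f : LInfty) : IsAlmostPeriodicOnCircle f ↔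
    ∀ t₀ ε : ℝ, 0 < ε → ∃ s ∈ Ioo 0 Real.pi, ∀ k : ℤˣ, ∃ fk : Circle → ℂ,
      IsAlmostPeriodicOnArc t₀ k s fk ∧
        ∀ᵐ z ∂arcLength.restrict (openArc t₀ k s), ‖f z - fk z‖ < ε := by
  constructor
  · intro h t₀ ε hε
    obtain ⟨s, hs, h⟩ := h t₀ ε hε
    refine ⟨s, hs, fun k => ?_⟩
    obtain ⟨fk, h1, h2⟩ := h k
    refine ⟨fk, h1, ?_⟩
    filter_upwards [ae_lt_of_essSup_lt h2] with z hz
    rw [← ofReal_norm] at hz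
    exact (ENNReal.ofReal_lt_ofReal_iff hε).1 hz
  · intro h t₀ ε hε
    obtain ⟨s, hs, h⟩ := h t₀ (ε / 2) (by positivity)
    refine ⟨s, hs, fun k => ?_⟩
    obtain ⟨fk, h1, h2⟩ := h k
    refine ⟨fk, h1, lt_of_le_of_lt (b := ENNReal.ofReal (ε / 2)) (essSup_le_of_ae_le _ ?_)
      ((ENNReal.ofReal_lt_ofReal_iff hε).2 (by linarith))⟩
    filter_upwards [h2] with z hz
    rw [← ofReal_norm]
    exact ENNReal.ofReal_le_ofReal hz.le

theorem restrict_openArc_ae_mono {t₀ : ℝ} {k : ℤˣ} {s s' : ℝ} (hs : s' ≤ s) {p : Circle → Prop}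
    (h : ∀ᵐ z ∂arcLength.restrict (openArc t₀ k s), p z) :
    ∀ᵐ z ∂arcLength.restrict (openArc t₀ k s'), p z :=
  ae_restrict_of_ae_restrict_of_subset (image_mono (Ioo_subset_Ioo_right hs)) h

theorem IsAlmostPeriodicOnCircle.add {f g : LInfty} (hf : IsAlmostPeriodicOnCircle f)
    (hg : IsAlmostPeriodicOnCircle g) : IsAlmostPeriodicOnCircle (f + g) := by
  rw [isAlmostPeriodicOnCircle_iff] at *
  intro t₀ ε hε
  obtain ⟨s₁, hs₁, hf⟩ := hf t₀ (ε / 2) (by positivity)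
  obtain ⟨s₂, hs₂, hg⟩ := hg t₀ (ε / 2) (by positivity)
  have hs : 0 < min s₁ s₂ := lt_min hs₁.1 hs₂.1
  refine ⟨min s₁ s₂, ⟨hs, (min_le_left _ _).trans_lt hs₁.2⟩, fun k => ?_⟩
  obtain ⟨fk, hfk, hf⟩ := hf k
  obtain ⟨gk, hgk, hg⟩ := hg k
  refine ⟨_, (hfk.mono hs (min_le_left _ _)).add (hgk.mono hs (min_le_right _ _)), ?_⟩
  filter_upwards [restrict_openArc_ae_mono (min_le_left _ _) hf,
    restrict_openArc_ae_mono (min_le_right _ _) hg,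
    ae_restrict_of_ae (Lp.coeFn_add f g)] with z h1 h2 h3
  rw [h3, Pi.add_apply, add_sub_add_comm]
  exact (norm_add_le _ _).trans_lt (by linarith)

theorem IsAlmostPeriodicOnCircle.mul {f g : LInfty} (hf : IsAlmostPeriodicOnCircle f)
    (hg : IsAlmostPeriodicOnCircle g) : IsAlmostPeriodicOnCircle (f * g) := by
  rw [isAlmostPeriodicOnCircle_iff] at *
  intro t₀ ε hε
  set δ := min 1 (ε / (‖f‖ + ‖g‖ + 2)) with hδ
  have hδ0 : 0 < δ := by positivity
  obtain ⟨s₁, hs₁, hf⟩ := hf t₀ δ hδ0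
  obtain ⟨s₂, hs₂, hg⟩ := hg t₀ δ hδ0
  have hs : 0 < min s₁ s₂ := lt_min hs₁.1 hs₂.1
  refine ⟨min s₁ s₂, ⟨hs, (min_le_left _ _).trans_lt hs₁.2⟩, fun k => ?_⟩
  obtain ⟨fk, hfk, hf⟩ := hf k
  obtain ⟨gk, hgk, hg⟩ := hg k
  refine ⟨_, (hfk.mono hs (min_le_left _ _)).mul (hgk.mono hs (min_le_right _ _)), ?_⟩
  filter_upwards [restrict_openArc_ae_mono (min_le_left _ _) hf,
    restrict_openArc_ae_mono (min_le_right _ _) hg, ae_restrict_of_ae (LInfty.coeFn_mul f g),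
    ae_restrict_of_ae (LInfty.ae_norm_le f),
    ae_restrict_of_ae (LInfty.ae_norm_le g)] with z h1 h2 h3 h4 h5
  rw [h3, show f z * g z - fk z * gk z = f z * (g z - gk z) + (f z - fk z) * gk z by ring]
  have h6 : ‖gk z‖ ≤ ‖g‖ + 1 := by
    have := norm_sub_norm_le (gk z) (g z)
    rw [norm_sub_rev] at this
    have hδ1 : δ ≤ 1 := min_le_left _ _
    linarith
  have h7 : δ * (‖f‖ + ‖g‖ + 2) ≤ ε := by
    rw [← le_div_iff₀ (by positivity)]; exact min_le_right _ _
  calc ‖f z * (g z - gk z) + (f z - fk z) * gk z‖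
      ≤ ‖f z‖ * ‖g z - gk z‖ + ‖f z - fk z‖ * ‖gk z‖ := by
        rw [← norm_mul, ← norm_mul]; exact norm_add_le _ _
    _ ≤ ‖f‖ * δ + δ * (‖g‖ + 1) := by gcongr
    _ < ε := by nlinarith

theorem IsAlmostPeriodicOnCircle.algebraMap (c : ℂ) :
    IsAlmostPeriodicOnCircle (algebraMap ℂ LInfty c) := by
  rw [isAlmostPeriodicOnCircle_iff]
  intro t₀ ε hε
  refine ⟨1, ⟨one_pos, by linarith [Real.pi_gt_three]⟩, fun k => ⟨_, .const t₀ k 1 c, ?_⟩⟩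
  filter_upwards [ae_restrict_of_ae (LInfty.coeFn_algebraMap c)] with z hz
  simpa [hz] using hε

/-- The algebra `AP(S)`. -/
def AP (S : Set Circle) : Subalgebra ℂ LInfty where
  carrier := {f | IsAlmostPeriodicOnCircle f ∧ HasContinuousRepOn f Sᶜ}
  mul_mem' hf hg := ⟨hf.1.mul hg.1, hf.2.mul hg.2⟩
  add_mem' hf hg := ⟨hf.1.add hg.1, hf.2.add hg.2⟩
  algebraMap_mem' c := ⟨.algebraMap c, .algebraMap c _⟩

/-- The algebra `R_S` of regulated functions: those continuous off `S` that have both one-sided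
limits (equal or not) at every point of `S`. -/
def Reg (S : Set Circle) : Subalgebra ℂ LInfty where
  carrier := {f | HasContinuousRepOn f Sᶜ ∧
    ∀ t₀ : ℝ, Circle.exp t₀ ∈ S → ∀ k : ℤˣ, ∃ L : ℂ, HasOneSidedLimit f t₀ k L}
  mul_mem' hf hg := ⟨hf.1.mul hg.1, fun t₀ ht k => by
    obtain ⟨L, hL⟩ := hf.2 t₀ ht k
    obtain ⟨M, hM⟩ := hg.2 t₀ ht k
    exact ⟨_, hL.mul hM⟩⟩
  add_mem' hf hg := ⟨hf.1.add hg.1, fun t₀ ht k => by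
    obtain ⟨L, hL⟩ := hf.2 t₀ ht k
    obtain ⟨M, hM⟩ := hg.2 t₀ ht k
    exact ⟨_, hL.add hM⟩⟩
  algebraMap_mem' c := ⟨.algebraMap c _, fun t₀ _ k => ⟨c, .algebraMap c t₀ k⟩⟩

/-! ### The embeddings `C(∂𝔻) → R_S → AP(S)` and the dual maps -/

theorem tendsto_arcPoint (t₀ : ℝ) (k : ℤˣ) :
    Tendsto (arcPoint t₀ k) (𝓝[>] 0) (𝓝 (Circle.exp t₀)) := by
  have h : Continuous (arcPoint t₀ k) :=
    Circle.exp.continuous.comp (continuous_const.add (continuous_const.mul continuous_id))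
  have := h.tendsto 0
  simp only [arcPoint, mul_zero, add_zero] at this
  exact this.mono_left nhdsWithin_le_nhds

theorem measurableSet_openArc (t₀ : ℝ) (k : ℤˣ) (s : ℝ) : MeasurableSet (openArc t₀ k s) := by
  have h : Continuous (arcPoint t₀ k) :=
    Circle.exp.continuous.comp (continuous_const.add (continuous_const.mul continuous_id))
  have hU : openArc t₀ k s = ⋃ n : ℕ, arcPoint t₀ k '' Icc (1 / (n + 1 : ℝ)) (s - 1 / (n + 1)) := by
    rw [← image_iUnion, openArc]
    congr 1
    ext t
    simp only [mem_Ioo, mem_iUnion, mem_Icc]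
    constructor
    · rintro ⟨h0, h1⟩
      obtain ⟨n, hn⟩ := exists_nat_one_div_lt (lt_min h0 (sub_pos.2 h1))
      exact ⟨n, (hn.trans_le (min_le_left _ _)).le,
        by linarith [hn.trans_le (min_le_right _ _)]⟩
    · rintro ⟨n, h0, h1⟩
      have : (0 : ℝ) < 1 / (n + 1) := by positivity
      exact ⟨by linarith, by linarith⟩
  rw [hU]
  exact MeasurableSet.iUnion fun n => (isCompact_Icc.image h).measurableSet

theorem Reg.exists_limit {S : Set Circle} (hS : IsClosed S) {f : LInfty} (hf : f ∈ Reg S)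
    (t₀ : ℝ) (k : ℤˣ) : ∃ L : ℂ, HasOneSidedLimit f t₀ k L := by
  by_cases ht : Circle.exp t₀ ∈ S
  · exact hf.2 t₀ ht k
  · obtain ⟨g, hg, hc⟩ := hf.1
    exact ⟨g (Circle.exp t₀), g, hg,
      (hc.continuousAt (hS.isOpen_compl.mem_nhds ht)).tendsto.comp (tendsto_arcPoint t₀ k)⟩

theorem Reg_le_AP {S : Set Circle} (hS : IsClosed S) : Reg S ≤ AP S := by
  intro f hf
  refine ⟨(isAlmostPeriodicOnCircle_iff f).2 fun t₀ ε hε => ?_, hf.1⟩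
  have key : ∀ k : ℤˣ, ∃ L : ℂ, ∃ s : ℝ, 0 < s ∧
      ∀ᵐ z ∂arcLength.restrict (openArc t₀ k s), ‖f z - L‖ < ε := by
    intro k
    obtain ⟨L, g, hg, hL⟩ := Reg.exists_limit hS hf t₀ k
    have h1 : ∀ᶠ t in 𝓝[>] (0 : ℝ), ‖g (arcPoint t₀ k t) - L‖ < ε := by
      have := Metric.tendsto_nhds.1 hL ε hε
      simpa only [dist_eq_norm] using this
    obtain ⟨s, hs, hsub⟩ := (mem_nhdsGT_iff_exists_Ioo_subset).1 h1
    refine ⟨L, s, hs, ?_⟩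
    filter_upwards [ae_restrict_of_ae hg, ae_restrict_mem (measurableSet_openArc t₀ k s)]
      with z hfg hz
    obtain ⟨t, ht, rfl⟩ := hz
    rw [hfg]
    exact hsub ht
  choose L s hs h using key
  refine ⟨min (min (s 1) (s (-1))) 1, ⟨?_, ?_⟩, fun k => ⟨_, .const t₀ k _ (L k), ?_⟩⟩
  · have := hs 1
    have := hs (-1)
    positivity
  · exact (min_le_right _ _).trans_lt (by linarith [Real.pi_gt_three])
  · refine restrict_openArc_ae_mono ((min_le_left _ _).trans ?_) (h k)
    rcases Int.units_eq_one_or k with rfl | rfl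
    · exact min_le_left _ _
    · exact min_le_right _ _

/-- The embedding of `C(∂𝔻)` into `R_S`. -/
def contToReg (S : Set Circle) : C(Circle, ℂ) →A[ℂ] Reg S where
  toAlgHom :=
    AlgHom.ofLinearMap
      (LinearMap.codRestrict (Subalgebra.toSubmodule (Reg S))
        (ContinuousMap.toLp ∞ arcLength ℂ : C(Circle, ℂ) →L[ℂ] LInfty).toLinearMap fun f =>
        ⟨⟨f, ContinuousMap.coeFn_toLp arcLength f, f.continuous.continuousOn⟩, fun t₀ _ k =>
          ⟨f (Circle.exp t₀), f, ContinuousMap.coeFn_toLp arcLength f,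
            f.continuous.continuousAt.tendsto.comp (tendsto_arcPoint t₀ k)⟩⟩)
      (by
        refine Subtype.ext (Lp.ext ?_)
        exact (ContinuousMap.coeFn_toLp arcLength (1 : C(Circle, ℂ))).trans
          LInfty.coeFn_one.symm)
      (by
        intro f g
        refine Subtype.ext (Lp.ext ?_)
        refine (ContinuousMap.coeFn_toLp arcLength (f * g)).trans
          (EventuallyEq.trans ?_ (LInfty.coeFn_mul _ _).symm)
        filter_upwards [ContinuousMap.coeFn_toLp (p := ∞) (𝕜 := ℂ) arcLength f,
          ContinuousMap.coeFn_toLp (p := ∞) (𝕜 := ℂ) arcLength g] with z h1 h2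
        exact (congrArg₂ (· * ·) h1 h2).symm)
  cont := ((ContinuousMap.toLp ∞ arcLength ℂ :
    C(Circle, ℂ) →L[ℂ] LInfty).continuous).subtype_mk _

/-- The embedding of `R_S` into `AP(S)`. -/
def regToAP {S : Set Circle} (hS : IsClosed S) : Reg S →A[ℂ] AP S where
  toAlgHom := Subalgebra.inclusion (Reg_le_AP hS)
  cont := continuous_subtype_val.subtype_mk _

/-- The map of maximal ideal spaces dual to a homomorphism of algebras. -/
def dualMap {A B : Type*} [NormedCommRing A] [NormedAlgebra ℂ A] [NormedCommRing B]
    [NormedAlgebra ℂ B] (φ : A →A[ℂ] B) :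
    C(WeakDual.characterSpace ℂ B, WeakDual.characterSpace ℂ A) where
  toFun χ := ⟨StrongDual.toWeakDual
      ((WeakDual.CharacterSpace.toCLM χ).comp ⟨φ.toAlgHom.toLinearMap, φ.cont⟩), by
    rw [WeakDual.CharacterSpace.eq_set_map_one_map_mul]
    refine ⟨?_, fun a b => ?_⟩
    · change χ (φ 1) = 1
      rw [map_one, map_one]
    · change χ (φ (a * b)) = χ (φ a) * χ (φ b)
      rw [map_mul, map_mul]⟩
  continuous_toFun := Continuous.subtype_mk
    (WeakDual.continuous_of_continuous_eval fun a =>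
      (WeakDual.eval_continuous (φ a)).comp continuous_subtype_val) _

/-- The map `r_S`. -/
def rMap {S : Set Circle} (hS : IsClosed S) :
    C(WeakDual.characterSpace ℂ (AP S), WeakDual.characterSpace ℂ (Reg S)) :=
  dualMap (regToAP hS)

/-- The map `c_S`; characters of `C(∂𝔻)` are identified with points of `∂𝔻` by evaluation. -/
def cMap (S : Set Circle) : C(WeakDual.characterSpace ℂ (Reg S), Circle) :=
  ((WeakDual.CharacterSpace.homeoEval Circle ℂ).symm : C(_, _)).comp (dualMap (contToReg S))

end

/-!
Everything rests on the behaviour of functions at a point `z` of the circle from one side `k = ±1`,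
in terms of the arc length `arcParam z k` from `z` in the direction `k`. A function `f` in
`AP(∂𝔻)` is asymptotic there to an almost periodic function `G` of the logarithm of this length.
`G` is unique, because an almost periodic function takes all its values, up to any error, near
`-∞` (`IsAlmostPeriodic.norm_le_of_forall_lt`), and `f ↦ G` is a contractive homomorphism
`apLimit S z k : AP(S) → AP(ℝ)`. It maps `f` to a constant if `f` has a one-sided limit; hence
all characters `ψ ∘ apLimit S z k`, for `ψ` in `bℝ`, have the same restriction `sideChar hS z k` to
`R_S`, the limit from the side `k`.

* Over `z ∈ S`, a character of `R_S` kills every function with both one-sided limits zero at `z`,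
  since such a function becomes small after multiplication with a continuous bump at `z`. Modulo
  these functions `R_S` is spanned by `1` and an idempotent, so that the two side characters are
  the only ones (`eq_sideChar_of_cMap_eq`).
* In the same way, a character of `AP(S)` over `sideChar hS z k` kills the kernel of
  `apLimit S z k`; now the bump is the function of `exists_Reg_bump`, which is supported on one side
  of `z` and lies in `R_S`. As `apLimit S z k` is onto, composition with it is a continuous bijection
  of `bℝ` onto the fibre of `r_S`, and so a homeomorphism (`nonempty_fibre_homeomorph`).
* Off `S`, the product of a function in `AP(S)` with the distance from `S` is continuous on the
  whole circle. So a character over `z ∉ S` is the evaluation at `z` (`eq_evalChar`), which depends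
  continuously on `z`; this inverts `c_S` and `r_S`.
* A connected set over `S` with two points has infinite image in `S`, and then the indicator
  function of a suitable arc with endpoints in `S`, an idempotent of `R_S`, disconnects it
  (`isTotallyDisconnected_preimage_cMap`).

Characters are continuous by definition, so they are contractive, and character spaces compact,
whether or not the algebra is known to be complete; completeness is used for `AP(ℝ)` only.
-/

noncomputable section

/-! ### Characters of normed algebras -/

section Characters

variable {A : Type*} [NormedCommRing A] [NormedAlgebra ℂ A]

/-- Characters are contractive even when the algebra is not assumed complete: continuity bounds
all powers `χ a ^ n = χ (a ^ n)` by a constant times `‖a‖ ^ n`. -/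
theorem WeakDual.CharacterSpace.norm_apply_le (χ : WeakDual.characterSpace ℂ A) (a : A) :
    ‖χ a‖ ≤ ‖a‖ := by
  by_contra! h
  set C := ‖WeakDual.CharacterSpace.toCLM χ‖
  have hpos : 0 < ‖χ a‖ := (norm_nonneg a).trans_lt h
  have hr : ‖a‖ / ‖χ a‖ < 1 := (div_lt_one hpos).2 h
  have hlim := (tendsto_pow_atTop_nhds_zero_of_lt_one (by positivity) hr).const_mul C
  rw [mul_zero] at hlim
  obtain ⟨n, hn, hn0⟩ :=
    ((hlim.eventually (gt_mem_nhds one_pos)).and (eventually_gt_atTop 0)).exists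
  have h1 : ‖χ a‖ ^ n ≤ C * ‖a‖ ^ n := by
    rw [← norm_pow, ← map_pow]
    exact ((WeakDual.CharacterSpace.toCLM χ).le_opNorm _).trans
      (mul_le_mul_of_nonneg_left (norm_pow_le' a hn0) (norm_nonneg _))
  rw [div_pow, mul_div_assoc', div_lt_one (by positivity)] at hn
  linarith

/-- Compactness of the character space of a normed algebra that need not be complete. -/
theorem WeakDual.CharacterSpace.isCompact_characterSpace :
    IsCompact (WeakDual.characterSpace ℂ A) := by
  refine (WeakDual.isCompact_closedBall (0 : StrongDual ℂ A) 1).of_isClosed_subset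
    WeakDual.CharacterSpace.isClosed fun φ hφ => ?_
  rw [mem_preimage, mem_closedBall_zero_iff]
  refine ContinuousLinearMap.opNorm_le_bound _ zero_le_one fun a => ?_
  rw [one_mul]
  exact WeakDual.CharacterSpace.norm_apply_le ⟨φ, hφ⟩ a

/-- A multiplicative unital continuous linear functional as a point of the character space. -/
def charMk (φ : A →ₐ[ℂ] ℂ) (hφ : ∀ a, ‖φ a‖ ≤ ‖a‖) : WeakDual.characterSpace ℂ A :=
  ⟨StrongDual.toWeakDual (φ.toLinearMap.mkContinuous 1 fun a => by simpa using hφ a), by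
    rw [WeakDual.CharacterSpace.eq_set_map_one_map_mul]
    exact ⟨map_one φ, map_mul φ⟩⟩

theorem WeakDual.CharacterSpace.continuous_of_apply {X : Type*} [TopologicalSpace X]
    {φ : X → WeakDual.characterSpace ℂ A} (h : ∀ a, Continuous fun x => φ x a) : Continuous φ :=
  continuous_induced_rng.2 (WeakDual.continuous_of_continuous_eval h)

theorem dualMap_apply {B : Type*} [NormedCommRing B] [NormedAlgebra ℂ B] (φ : A →A[ℂ] B)
    (χ : WeakDual.characterSpace ℂ B) (a : A) : dualMap φ χ a = χ (φ a) := rfl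

end Characters

/-! ### Almost periodic functions near `-∞` -/

/-- An almost periodic function takes, up to any error, all its values near `-∞`. -/
theorem IsAlmostPeriodic.norm_le_of_forall_lt {G : ℝ → ℂ} (hG : IsAlmostPeriodic G) {C a : ℝ}
    (h : ∀ u < a, ‖G u‖ ≤ C) (u : ℝ) : ‖G u‖ ≤ C := by
  refine le_of_forall_pos_le_add fun ε hε => ?_
  obtain ⟨l, -, hl⟩ := hG.2 ε hε
  obtain ⟨τ, hτ, hτ'⟩ := hl (a - 1 - l - u)
  have h1 := h (u + τ) (by linarith [hτ.2])
  have h2 := norm_sub_norm_le (G u) (G (u + τ))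
  linarith [hτ' u]

theorem isClosed_APReal : IsClosed (APReal : Set (ℝ →ᵇ ℂ)) := by
  refine isClosed_of_closure_subset fun f hf => ?_
  refine ⟨f.continuous, fun ε hε => ?_⟩
  obtain ⟨g, hg, hfg⟩ := Metric.mem_closure_iff.1 hf (ε / 3) (by positivity)
  obtain ⟨l, hl, h⟩ := And.right (show IsAlmostPeriodic g from hg) (ε / 3) (by positivity)
  refine ⟨l, hl, fun t₀ => ?_⟩
  obtain ⟨τ, hτ, h⟩ := h t₀
  refine ⟨τ, hτ, fun t => ?_⟩
  have h1 : ∀ t, ‖f t - g t‖ < ε / 3 := fun t => by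
    rw [← dist_eq_norm]; exact (BoundedContinuousFunction.dist_coe_le_dist t).trans_lt hfg
  have h2 := norm_add₃_le (a := f t - g t) (b := g t - g (t + τ)) (c := g (t + τ) - f (t + τ))
  rw [sub_add_sub_cancel, sub_add_sub_cancel] at h2
  have h3 := h1 (t + τ)
  rw [norm_sub_rev] at h3
  linarith [h1 t, h t]

instance APReal.instCompleteSpace : CompleteSpace APReal :=
  isClosed_APReal.isComplete.completeSpace_coe

/-- An almost periodic function as an element of the uniform algebra `APReal`. -/
def IsAlmostPeriodic.toAPReal {F : ℝ → ℂ} (hF : IsAlmostPeriodic F) : APReal :=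
  ⟨BoundedContinuousFunction.ofNormedAddCommGroup F hF.1 hF.bounded.choose
    hF.bounded.choose_spec.2, hF⟩

theorem IsAlmostPeriodic.toAPReal_apply {F : ℝ → ℂ} (hF : IsAlmostPeriodic F) (u : ℝ) :
    (hF.toAPReal : ℝ →ᵇ ℂ) u = F u := rfl

theorem APReal.isAlmostPeriodic (G : APReal) : IsAlmostPeriodic (G : ℝ →ᵇ ℂ) := G.2

theorem APReal.norm_coe_le (G : APReal) (u : ℝ) : ‖(G : ℝ →ᵇ ℂ) u‖ ≤ ‖G‖ :=
  BoundedContinuousFunction.norm_coe_le_norm _ u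

theorem APReal.norm_le (G : APReal) {C : ℝ} (hC : 0 ≤ C) :
    ‖G‖ ≤ C ↔ ∀ u, ‖(G : ℝ →ᵇ ℂ) u‖ ≤ C :=
  BoundedContinuousFunction.norm_le hC

/-! ### Arc length -/

instance arcLength.instIsOpenPosMeasure : arcLength.IsOpenPosMeasure := by
  refine ⟨fun U hU ⟨z, hz⟩ => ?_⟩
  rw [arcLength, Measure.map_apply Circle.exp.continuous.measurable hU.measurableSet,
    Measure.restrict_apply (Circle.exp.continuous.measurable hU.measurableSet)]
  have hV : IsOpen (Circle.exp ⁻¹' U) := hU.preimage Circle.exp.continuous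
  have hz' : Complex.arg z ∈ closure (Ioo (-Real.pi) Real.pi) := by
    rw [closure_Ioo (by linarith [Real.pi_pos])]
    exact ⟨(Complex.neg_pi_lt_arg _).le, Complex.arg_le_pi _⟩
  have hne : (Circle.exp ⁻¹' U ∩ Ioo (-Real.pi) Real.pi).Nonempty :=
    mem_closure_iff.1 hz' _ hV (by rwa [mem_preimage, Circle.exp_arg])
  exact (((hV.inter isOpen_Ioo).measure_pos volume hne).trans_le
    (measure_mono (inter_subset_inter_right _ Ioo_subset_Ioc_self))).ne'

instance arcLength.instNullSingletonClass : NullSingletonClass arcLength := by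
  refine ⟨fun z => ?_⟩
  rw [arcLength, Measure.map_apply Circle.exp.continuous.measurable (measurableSet_singleton z),
    Measure.restrict_apply (Circle.exp.continuous.measurable (measurableSet_singleton z))]
  refine Set.Subsingleton.measure_zero ?_ _
  rintro x ⟨hx, hx'⟩ y ⟨hy, hy'⟩
  have h : Circle.exp x = Circle.exp y := by
    rw [mem_preimage, mem_singleton_iff] at hx hy
    rw [hx, hy]
  exact Circle.exp_injOn_Ioc (by linarith [Real.pi_pos]) hx' hy' h

/-! ### The arc length parameter at a point of the circle -/

/-- The distance from `z₀` to `w` along the circle in the direction `k`, with values in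
`(0, 2π]`; the value at `z₀` itself is `2π`. -/
def arcParam (z₀ : Circle) (k : ℤˣ) (w : Circle) : ℝ :=
  Real.pi + Complex.arg ((-(w / z₀) ^ (k : ℤ) : Circle) : ℂ)

theorem arcParam_pos (z₀ : Circle) (k : ℤˣ) (w : Circle) : 0 < arcParam z₀ k w := by
  have := Complex.neg_pi_lt_arg ((-(w / z₀) ^ (k : ℤ) : Circle) : ℂ)
  unfold arcParam; linarith

theorem arcParam_le (z₀ : Circle) (k : ℤˣ) (w : Circle) : arcParam z₀ k w ≤ 2 * Real.pi := by
  have := Complex.arg_le_pi ((-(w / z₀) ^ (k : ℤ) : Circle) : ℂ)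
  unfold arcParam; linarith

theorem Circle.exp_pi : Circle.exp Real.pi = -1 := by
  ext; simp [Circle.coe_exp]

theorem exp_arcParam (z₀ : Circle) (k : ℤˣ) (w : Circle) :
    Circle.exp (arcParam z₀ k w) = (w / z₀) ^ (k : ℤ) := by
  rw [arcParam, Circle.exp_add, Circle.exp_arg, Circle.exp_pi, neg_mul_neg, one_mul]

theorem arcPoint_eq (t₀ : ℝ) (k : ℤˣ) (t : ℝ) :
    arcPoint t₀ k t = Circle.exp t₀ * Circle.exp t ^ (k : ℤ) := by
  rw [arcPoint, Circle.exp_add, Circle.exp_intCast_mul]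

theorem zpow_units_zpow_units {G : Type*} [Group G] (g : G) (k : ℤˣ) :
    (g ^ (k : ℤ)) ^ (k : ℤ) = g := by
  rw [← zpow_mul, ← Units.val_mul, Int.units_mul_self, Units.val_one, zpow_one]

theorem arcPoint_arcParam (t₀ : ℝ) (k : ℤˣ) (w : Circle) :
    arcPoint t₀ k (arcParam (Circle.exp t₀) k w) = w := by
  rw [arcPoint_eq, exp_arcParam, zpow_units_zpow_units, mul_div_cancel]

theorem arcParam_arcPoint (t₀ : ℝ) (k : ℤˣ) {t : ℝ} (h0 : 0 < t) (h1 : t ≤ 2 * Real.pi) :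
    arcParam (Circle.exp t₀) k (arcPoint t₀ k t) = t := by
  have h : -((arcPoint t₀ k t) / Circle.exp t₀) ^ (k : ℤ) = Circle.exp (t - Real.pi) := by
    rw [arcPoint_eq, mul_div_cancel_left, zpow_units_zpow_units, Circle.exp_sub, Circle.exp_pi,
      div_neg, div_one]
  rw [arcParam, h, Circle.arg_exp (by linarith) (by linarith)]
  ring

theorem arcParam_injective (z₀ : Circle) (k : ℤˣ) : Function.Injective (arcParam z₀ k) := by
  obtain ⟨t₀, rfl⟩ := Circle.exp_surjective z₀
  exact Function.LeftInverse.injective (arcPoint_arcParam t₀ k)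

theorem arcParam_self (z₀ : Circle) (k : ℤˣ) : arcParam z₀ k z₀ = 2 * Real.pi := by
  rw [arcParam, div_self', one_zpow, Circle.coe_neg, Circle.coe_one, Complex.arg_neg_one]
  ring

theorem arcParam_lt {z₀ : Circle} (k : ℤˣ) {w : Circle} (h : w ≠ z₀) :
    arcParam z₀ k w < 2 * Real.pi :=
  (arcParam_le z₀ k w).lt_of_ne fun h' => h (arcParam_injective z₀ k
    (h'.trans (arcParam_self z₀ k).symm))

/-- Walking away from `z₀` in one direction, the distance in the opposite direction decreases
from `2π`. -/
theorem arcParam_arcPoint_neg (t₀ : ℝ) (k : ℤˣ) {t : ℝ} (h0 : 0 ≤ t) (h1 : t < 2 * Real.pi) :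
    arcParam (Circle.exp t₀) k (arcPoint t₀ (-k) t) = 2 * Real.pi - t := by
  rw [← arcParam_arcPoint t₀ k (t := 2 * Real.pi - t) (by linarith) (by linarith)]
  congr 1
  rw [arcPoint_eq, arcPoint_eq, Circle.exp_sub, Circle.exp_two_pi, one_div, inv_zpow', Units.val_neg]

theorem continuousAt_arcParam {z₀ : Circle} (k : ℤˣ) {w : Circle} (h : w ≠ z₀) :
    ContinuousAt (arcParam z₀ k) w := by
  refine continuousAt_const.add ?_
  have h1 : Continuous fun w : Circle => ((-(w / z₀) ^ (k : ℤ) : Circle) : ℂ) := by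
    simp only [Circle.coe_neg]
    exact (continuous_induced_dom.comp (by fun_prop)).neg
  refine ContinuousAt.comp (f := fun w : Circle => ((-(w / z₀) ^ (k : ℤ) : Circle) : ℂ))
    (Complex.continuousAt_arg ?_) h1.continuousAt
  rw [Complex.mem_slitPlane_iff_arg]
  refine ⟨fun h' => ?_, Circle.coe_ne_zero _⟩
  have := arcParam_lt k h
  rw [arcParam, h'] at this
  linarith

theorem arcParam_lt_iff_ne {z₀ : Circle} (k : ℤˣ) {w : Circle} :
    arcParam z₀ k w < 2 * Real.pi ↔ w ≠ z₀ :=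
  ⟨fun h h' => by rw [h', arcParam_self] at h; exact lt_irrefl _ h, arcParam_lt k⟩

theorem isOpen_arcParam_lt (z₀ : Circle) (k : ℤˣ) {s : ℝ} (hs : s ≤ 2 * Real.pi) :
    IsOpen {w | arcParam z₀ k w < s} := by
  rw [isOpen_iff_mem_nhds]
  intro w hw
  exact (continuousAt_arcParam k ((arcParam_lt_iff_ne k).1 (lt_of_lt_of_le hw hs))).eventually
    (gt_mem_nhds hw)

theorem openArc_eq (t₀ : ℝ) (k : ℤˣ) {s : ℝ} (hs : s ≤ 2 * Real.pi) :
    openArc t₀ k s = {w | arcParam (Circle.exp t₀) k w < s} := by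
  ext w
  constructor
  · rintro ⟨t, ht, rfl⟩
    rw [mem_ofPred_eq, arcParam_arcPoint t₀ k ht.1 (ht.2.le.trans hs)]
    exact ht.2
  · intro hw
    exact ⟨_, ⟨arcParam_pos _ _ _, hw⟩, arcPoint_arcParam t₀ k w⟩

/-! ### One-sided limits and almost periodic limits -/

/-- The filter of approach to `z` along the arcs issuing from `z` in the direction `k`, up to null
sets. -/
def sideFilter (z : Circle) (k : ℤˣ) : Filter Circle :=
  ae arcLength ⊓ comap (arcParam z k) (𝓝[>] 0)

theorem eventually_sideFilter_exp_iff {t₀ : ℝ} {k : ℤˣ} {p : Circle → Prop} :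
    (∀ᶠ w in sideFilter (Circle.exp t₀) k, p w) ↔
      ∃ s ∈ Ioo 0 Real.pi, ∀ᵐ w ∂arcLength.restrict (openArc t₀ k s), p w := by
  have key : ∀ s ∈ Ioo 0 Real.pi, (∀ᵐ w ∂arcLength.restrict (openArc t₀ k s), p w) ↔
      ∀ᵐ w ∂arcLength, arcParam (Circle.exp t₀) k w < s → p w := fun s hs => by
    rw [ae_restrict_iff' (measurableSet_openArc t₀ k s),
      openArc_eq t₀ k (by linarith [hs.2, Real.pi_pos])]
    rfl
  constructor
  · intro h
    obtain ⟨U, hU, V, hV, hUV⟩ := mem_inf_iff_superset.1 h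
    obtain ⟨T, hT, hTV⟩ := mem_comap.1 hV
    obtain ⟨s, hs, hsT⟩ := mem_nhdsGT_iff_exists_Ioo_subset.1 hT
    have hs' : min s 1 ∈ Ioo 0 Real.pi :=
      ⟨lt_min hs one_pos, (min_le_right _ _).trans_lt (by linarith [Real.pi_gt_three])⟩
    refine ⟨min s 1, hs', (key _ hs').2 ?_⟩
    filter_upwards [hU] with w hw hws
    exact hUV ⟨hw, hTV (hsT ⟨arcParam_pos _ _ _, hws.trans_le (min_le_left _ _)⟩)⟩
  · rintro ⟨s, hs, h⟩
    rw [key s hs] at h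
    filter_upwards [mem_inf_of_left h, mem_inf_of_right (preimage_mem_comap (Ioo_mem_nhdsGT hs.1))]
      with w hw hws
    exact hw hws.2

theorem eventually_sideFilter_of_ae {z : Circle} {k : ℤˣ} {p : Circle → Prop}
    (h : ∀ᵐ w ∂arcLength, p w) : ∀ᶠ w in sideFilter z k, p w :=
  mem_inf_of_left h

theorem tendsto_arcParam_sideFilter (z : Circle) (k : ℤˣ) :
    Tendsto (arcParam z k) (sideFilter z k) (𝓝[>] 0) :=
  tendsto_comap.mono_left inf_le_right

/-- Bounds on an almost periodic function of the logarithmic distance from `z` that hold near `z`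
hold everywhere. -/
theorem IsAlmostPeriodic.norm_le_of_eventually_sideFilter {G : ℝ → ℂ} (hG : IsAlmostPeriodic G)
    {z : Circle} {k : ℤˣ} {C : ℝ}
    (h : ∀ᶠ w in sideFilter z k, ‖G (Real.log (arcParam z k w))‖ ≤ C) (u : ℝ) : ‖G u‖ ≤ C := by
  obtain ⟨t₀, rfl⟩ := Circle.exp_surjective z
  obtain ⟨s, hs, h⟩ := eventually_sideFilter_exp_iff.1 h
  have hs2 : s ≤ 2 * Real.pi := by linarith [hs.2, hs.1]
  rw [ae_restrict_iff' (measurableSet_openArc t₀ k s), openArc_eq t₀ k hs2] at h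
  set τ := arcParam (Circle.exp t₀) k
  have hopen : IsOpen {w | τ w < s ∧ C < ‖G (Real.log (τ w))‖} := by
    rw [isOpen_iff_mem_nhds]
    rintro w ⟨hw, hw'⟩
    have hc : ContinuousAt τ w :=
      continuousAt_arcParam k ((arcParam_lt_iff_ne k).1 (lt_of_lt_of_le hw hs2))
    have hc' : ContinuousAt (fun w => ‖G (Real.log (τ w))‖) w :=
      (hG.1.continuousAt.comp (hc.log (arcParam_pos _ _ _).ne')).norm
    exact (hc.eventually (gt_mem_nhds hw)).and (hc'.eventually (lt_mem_nhds hw'))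
  have hempty : {w | τ w < s ∧ C < ‖G (Real.log (τ w))‖} = ∅ := by
    refine (hopen.measure_eq_zero_iff arcLength).1 (measure_mono_null ?_ h)
    rintro w ⟨hw, hw'⟩ h'
    exact not_le.2 hw' (h' hw)
  refine hG.norm_le_of_forall_lt (a := Real.log s) (fun u hu => ?_) u
  have hus : Real.exp u < s := (Real.lt_log_iff_exp_lt hs.1).1 hu
  have hτ : τ (arcPoint t₀ k (Real.exp u)) = Real.exp u :=
    arcParam_arcPoint t₀ k (Real.exp_pos u) (hus.le.trans hs2)
  by_contra! hC
  refine (eq_empty_iff_forall_notMem.1 hempty) (arcPoint t₀ k (Real.exp u)) ⟨?_, ?_⟩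
  · rwa [hτ]
  · rwa [hτ, Real.log_exp]

/-- Near `z`, on the side `k`, the function `f` is asymptotic to the function `G` of the
logarithm of the distance from `z`. -/
def HasAPLimit (f : LInfty) (z : Circle) (k : ℤˣ) (G : ℝ → ℂ) : Prop :=
  Tendsto (fun w => f w - G (Real.log (arcParam z k w))) (sideFilter z k) (𝓝 0)

theorem HasAPLimit.of_rep {f : LInfty} {g : Circle → ℂ} {t₀ : ℝ} {k : ℤˣ} {G : ℝ → ℂ}
    (hfg : f =ᵐ[arcLength] g)
    (h : Tendsto (fun t => g (arcPoint t₀ k t) - G (Real.log t)) (𝓝[>] 0) (𝓝 0)) :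
    HasAPLimit f (Circle.exp t₀) k G := by
  refine (h.comp (tendsto_arcParam_sideFilter (Circle.exp t₀) k)).congr' ?_
  filter_upwards [eventually_sideFilter_of_ae hfg] with w hw
  rw [Function.comp_apply, arcPoint_arcParam, hw]

theorem HasOneSidedLimit.hasAPLimit {f : LInfty} {t₀ : ℝ} {k : ℤˣ} {L : ℂ}
    (h : HasOneSidedLimit f t₀ k L) : HasAPLimit f (Circle.exp t₀) k fun _ => L := by
  obtain ⟨g, hfg, h⟩ := h
  exact .of_rep hfg (by simpa using h.sub_const L)

namespace HasAPLimit

variable {f g : LInfty} {z : Circle} {k : ℤˣ} {G H : ℝ → ℂ}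

theorem add (hf : HasAPLimit f z k G) (hg : HasAPLimit g z k H) :
    HasAPLimit (f + g) z k fun u => G u + H u := by
  have := Tendsto.add hf hg
  rw [add_zero] at this
  refine this.congr' ?_
  filter_upwards [eventually_sideFilter_of_ae (Lp.coeFn_add f g)] with w hw
  rw [hw, Pi.add_apply]
  ring

theorem mul (hf : HasAPLimit f z k G) (hg : HasAPLimit g z k H) (hG : IsAlmostPeriodic G) :
    HasAPLimit (f * g) z k fun u => G u * H u := by
  obtain ⟨C, -, hC⟩ := hG.bounded
  have h1 : Tendsto (fun w => (f w - G (Real.log (arcParam z k w))) * g w) (sideFilter z k)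
      (𝓝 0) := by
    refine Tendsto.zero_mul_isBoundedUnder_le hf (isBoundedUnder_of_eventually_le (a := ‖g‖) ?_)
    exact eventually_sideFilter_of_ae (LInfty.ae_norm_le g)
  have h2 : Tendsto (fun w => (g w - H (Real.log (arcParam z k w))) *
      G (Real.log (arcParam z k w))) (sideFilter z k) (𝓝 0) :=
    Tendsto.zero_mul_isBoundedUnder_le hg
      (isBoundedUnder_of_eventually_le (a := C) (Eventually.of_forall fun _ => hC _))
  have := h1.add h2
  rw [add_zero] at this
  refine this.congr' ?_
  filter_upwards [eventually_sideFilter_of_ae (LInfty.coeFn_mul f g)] with w hw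
  rw [hw]
  ring

theorem algebraMap (c : ℂ) (z : Circle) (k : ℤˣ) :
    HasAPLimit (algebraMap ℂ LInfty c) z k fun _ => c := by
  obtain ⟨t₀, rfl⟩ := Circle.exp_surjective z
  exact (HasOneSidedLimit.algebraMap c t₀ k).hasAPLimit

/-- Almost periodic limits are no larger than the function. -/
theorem norm_le (hf : HasAPLimit f z k G) (hG : IsAlmostPeriodic G) (u : ℝ) : ‖G u‖ ≤ ‖f‖ := by
  refine le_of_forall_pos_le_add fun ε hε => ?_
  refine hG.norm_le_of_eventually_sideFilter (z := z) (k := k) ?_ u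
  filter_upwards [Metric.tendsto_nhds.1 hf ε hε,
    eventually_sideFilter_of_ae (LInfty.ae_norm_le f)] with w h1 h2
  rw [dist_zero_right, norm_sub_rev] at h1
  linarith [norm_le_norm_add_norm_sub' (G (Real.log (arcParam z k w))) (f w)]

theorem unique (hf : HasAPLimit f z k G) (hf' : HasAPLimit f z k H) (hG : IsAlmostPeriodic G)
    (hH : IsAlmostPeriodic H) : G = H := by
  have hGH : IsAlmostPeriodic fun u => G u + -1 * H u := hG.add ((IsAlmostPeriodic.const _).mul hH)
  have h : HasAPLimit 0 z k fun u => G u + -1 * H u := by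
    have := hf.add ((algebraMap (-1) z k).mul hf' (.const _))
    simpa using this
  funext u
  have := h.norm_le hGH u
  rw [norm_zero, norm_le_zero_iff] at this
  linear_combination this

end HasAPLimit

/-- A function in `AP(∂𝔻)` has an almost periodic limit at every point, from either side: the
almost periodic functions in the definition form a Cauchy sequence as the error tends to `0`. -/
theorem IsAlmostPeriodicOnCircle.exists_hasAPLimit {f : LInfty} (hf : IsAlmostPeriodicOnCircle f)
    (z : Circle) (k : ℤˣ) : ∃ G : APReal, HasAPLimit f z k (G : ℝ →ᵇ ℂ) := by
  obtain ⟨t₀, rfl⟩ := Circle.exp_surjective z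
  set τ := arcParam (Circle.exp t₀) k
  have key : ∀ ε > 0, ∃ G : APReal, ∀ᶠ w in sideFilter (Circle.exp t₀) k,
      ‖f w - (G : ℝ →ᵇ ℂ) (Real.log (τ w))‖ < ε := by
    intro ε hε
    obtain ⟨s, hs, h⟩ := (isAlmostPeriodicOnCircle_iff f).1 hf t₀ ε hε
    obtain ⟨fk, ⟨-, F, hF, hfF⟩, h⟩ := h k
    refine ⟨(hF.comp_add_const (-Real.log s)).toAPReal,
      eventually_sideFilter_exp_iff.2 ⟨s, hs, ?_⟩⟩
    filter_upwards [h, ae_restrict_mem (measurableSet_openArc t₀ k s)] with w hw hws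
    rw [openArc_eq t₀ k (by linarith [hs.1, hs.2])] at hws
    have hτ0 : 0 < τ w := arcParam_pos _ _ _
    rw [IsAlmostPeriodic.toAPReal_apply, ← hfF, Real.exp_add, Real.exp_neg, Real.exp_log hτ0,
      Real.exp_log hs.1, mul_comm (τ w), mul_inv_cancel_left₀ hs.1.ne', arcPoint_arcParam]
    · exact hw
    · linarith [Real.log_lt_log hτ0 hws]
  have hε : ∀ n : ℕ, (0 : ℝ) < 1 / (n + 1) := fun n => by positivity
  choose G hG using fun n : ℕ => key _ (hε n)
  have hcauchy : CauchySeq G := by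
    refine cauchySeq_of_le_tendsto_0 (fun N : ℕ => 1 / ((N : ℝ) + 1) + 1 / ((N : ℝ) + 1))
      (fun n m N hn hm => ?_) ?_
    · rw [dist_eq_norm, APReal.norm_le _ (by positivity)]
      refine (APReal.isAlmostPeriodic (G n - G m)).norm_le_of_eventually_sideFilter
        (z := Circle.exp t₀) (k := k) ?_
      filter_upwards [hG n, hG m] with w h1 h2
      rw [norm_sub_rev] at h1
      have h3 := norm_add_le ((G n : ℝ →ᵇ ℂ) (Real.log (τ w)) - f w)
        (f w - (G m : ℝ →ᵇ ℂ) (Real.log (τ w)))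
      rw [sub_add_sub_cancel] at h3
      exact h3.trans (add_le_add (h1.le.trans (Nat.one_div_le_one_div hn))
        (h2.le.trans (Nat.one_div_le_one_div hm)))
    · simpa using tendsto_one_div_add_atTop_nhds_zero_nat.add
        (tendsto_one_div_add_atTop_nhds_zero_nat (𝕜 := ℝ))
  obtain ⟨Ginf, hGinf⟩ := cauchySeq_tendsto_of_complete hcauchy
  refine ⟨Ginf, Metric.tendsto_nhds.2 fun ε hε => ?_⟩
  have h1 := tendsto_one_div_add_atTop_nhds_zero_nat (𝕜 := ℝ) |>.eventually
    (gt_mem_nhds (half_pos hε))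
  obtain ⟨n, hn, hn'⟩ := (h1.and (Metric.tendsto_nhds.1 hGinf _ (half_pos hε))).exists
  filter_upwards [hG n] with w hw
  rw [dist_zero_right]
  have h2 := APReal.norm_coe_le (G n - Ginf) (Real.log (τ w))
  rw [← dist_eq_norm] at h2
  have h3 := norm_add_le (f w - (G n : ℝ →ᵇ ℂ) (Real.log (τ w)))
    ((G n : ℝ →ᵇ ℂ) (Real.log (τ w)) - (Ginf : ℝ →ᵇ ℂ) (Real.log (τ w)))
  rw [sub_add_sub_cancel] at h3
  refine h3.trans_lt ?_
  have h4 : ‖(G n : ℝ →ᵇ ℂ) (Real.log (τ w)) - (Ginf : ℝ →ᵇ ℂ) (Real.log (τ w))‖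
    ≤ dist (G n) Ginf := h2
  linarith

theorem IsAlmostPeriodicOnCircle.of_hasAPLimit {f : LInfty}
    (h : ∀ t₀ k, ∃ G : ℝ → ℂ, IsAlmostPeriodic G ∧ HasAPLimit f (Circle.exp t₀) k G) :
    IsAlmostPeriodicOnCircle f := by
  rw [isAlmostPeriodicOnCircle_iff]
  intro t₀ ε hε
  have key : ∀ k : ℤˣ, ∃ s ∈ Ioo 0 Real.pi, ∃ fk : Circle → ℂ, IsAlmostPeriodicOnArc t₀ k s fk ∧
      ∀ᵐ w ∂arcLength.restrict (openArc t₀ k s), ‖f w - fk w‖ < ε := by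
    intro k
    obtain ⟨G, hG, hfG⟩ := h t₀ k
    obtain ⟨s, hs, hfs⟩ := eventually_sideFilter_exp_iff.1 (Metric.tendsto_nhds.1 hfG ε hε)
    have hs2 : s ≤ 2 * Real.pi := by linarith [hs.1, hs.2]
    refine ⟨s, hs, fun w => G (Real.log (arcParam (Circle.exp t₀) k w)),
      ⟨fun w hw => ContinuousAt.continuousWithinAt ?_, _, hG.comp_add_const (Real.log s),
        fun t ht => ?_⟩, by simpa only [dist_zero_right] using hfs⟩
    · rw [openArc_eq t₀ k hs2] at hw
      exact hG.1.continuousAt.comp ((continuousAt_arcParam k ((arcParam_lt_iff_ne k).1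
        (lt_of_lt_of_le hw hs2))).log (arcParam_pos _ _ _).ne')
    · have hle : s * Real.exp t ≤ s := mul_le_of_le_one_right hs.1.le (Real.exp_le_one_iff.2 ht.le)
      beta_reduce
      rw [arcParam_arcPoint t₀ k (mul_pos hs.1 (Real.exp_pos t)) (hle.trans hs2),
        Real.log_mul hs.1.ne' (Real.exp_pos t).ne', Real.log_exp, add_comm]
  choose s hs fk hfk hf using key
  have hmin : ∀ k, min (s 1) (s (-1)) ≤ s k := fun k => by
    rcases Int.units_eq_one_or k with rfl | rfl
    exacts [min_le_left _ _, min_le_right _ _]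
  have hpos : 0 < min (s 1) (s (-1)) := lt_min (hs 1).1 (hs (-1)).1
  exact ⟨min (s 1) (s (-1)), ⟨hpos, (hmin 1).trans_lt (hs 1).2⟩, fun k =>
    ⟨fk k, (hfk k).mono hpos (hmin k), restrict_openArc_ae_mono (hmin k) (hf k)⟩⟩

theorem AP.exists_hasAPLimit {S : Set Circle} (f : AP S) (z : Circle) (k : ℤˣ) :
    ∃ G : APReal, HasAPLimit f z k (G : ℝ →ᵇ ℂ) :=
  f.2.1.exists_hasAPLimit z k

/-- The almost periodic limit at `z` from the side `k`, as a homomorphism `AP(S) → AP(ℝ)`. -/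
def apLimit (S : Set Circle) (z : Circle) (k : ℤˣ) : AP S →A[ℂ] APReal :=
  have hspec (f : AP S) := (AP.exists_hasAPLimit f z k).choose_spec
  have huniq (f : AP S) (G : APReal) (hG : HasAPLimit f z k (G : ℝ →ᵇ ℂ)) :
      (AP.exists_hasAPLimit f z k).choose = G :=
    Subtype.ext (DFunLike.coe_injective
      ((hspec f).unique hG (APReal.isAlmostPeriodic _) (APReal.isAlmostPeriodic G)))
  let φ : AP S →ₐ[ℂ] APReal := AlgHom.ofLinearMap
    { toFun := fun f => (AP.exists_hasAPLimit f z k).choose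
      map_add' := fun f g => huniq _ _ ((hspec f).add (hspec g))
      map_smul' := fun c f => huniq _ _ (by
        rw [Algebra.smul_def]
        exact (HasAPLimit.algebraMap c z k).mul (hspec f) (.const c)) }
    (huniq 1 1 (by have := HasAPLimit.algebraMap 1 z k; rwa [map_one] at this))
    (fun f g => huniq _ _ ((hspec f).mul (hspec g) (APReal.isAlmostPeriodic _)))
  { toAlgHom := φ
    cont := (φ.toLinearMap.mkContinuous 1 fun f => by
      rw [one_mul, APReal.norm_le _ (norm_nonneg f)]
      exact (hspec f).norm_le (APReal.isAlmostPeriodic _)).continuous }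

theorem hasAPLimit_apLimit {S : Set Circle} (z : Circle) (k : ℤˣ) (f : AP S) :
    HasAPLimit f z k (apLimit S z k f : ℝ →ᵇ ℂ) :=
  (AP.exists_hasAPLimit f z k).choose_spec

theorem apLimit_eq {S : Set Circle} {z : Circle} {k : ℤˣ} {f : AP S} {G : APReal}
    (h : HasAPLimit f z k (G : ℝ →ᵇ ℂ)) : apLimit S z k f = G :=
  Subtype.ext (DFunLike.coe_injective
    ((hasAPLimit_apLimit z k f).unique h (APReal.isAlmostPeriodic _) (APReal.isAlmostPeriodic G)))

theorem apLimit_eq_algebraMap {S : Set Circle} {t₀ : ℝ} {k : ℤˣ} {f : AP S} {L : ℂ}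
    (h : HasOneSidedLimit f t₀ k L) :
    apLimit S (Circle.exp t₀) k f = algebraMap ℂ APReal L :=
  apLimit_eq h.hasAPLimit

/-! ### Functions with a single discontinuity -/

theorem LInfty.norm_le_of_ae {f : LInfty} {C : ℝ} (hC : 0 ≤ C)
    (h : ∀ᵐ w ∂arcLength, ‖f w‖ ≤ C) : ‖f‖ ≤ C := by
  rw [Lp.norm_def, eLpNorm_exponent_top]
  exact ENNReal.toReal_le_of_le_ofReal hC (eLpNormEssSup_le_of_ae_bound h)

theorem LInfty.exists_of_bounded {g : Circle → ℂ} (hg : Measurable g) {C : ℝ}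
    (hC : ∀ w, ‖g w‖ ≤ C) : ∃ f : LInfty, f =ᵐ[arcLength] g :=
  ⟨(memLp_top_of_bound hg.aestronglyMeasurable C (Eventually.of_forall hC)).toLp g,
    MemLp.coeFn_toLp _⟩

theorem HasOneSidedLimit.of_continuousAt {f : LInfty} {g : Circle → ℂ} {t₀ : ℝ}
    (hfg : f =ᵐ[arcLength] g) (hg : ContinuousAt g (Circle.exp t₀)) (k : ℤˣ) :
    HasOneSidedLimit f t₀ k (g (Circle.exp t₀)) :=
  ⟨g, hfg, hg.tendsto.comp (tendsto_arcPoint t₀ k)⟩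

/-- The function `G` of the logarithmic distance from `z` in the direction `k`, cut off linearly
at distance `s`. The only point where it may be discontinuous is `z`. -/
def arcBump (z : Circle) (k : ℤˣ) (s : ℝ) (G : ℝ → ℂ) (w : Circle) : ℂ :=
  G (Real.log (arcParam z k w)) * (max 0 (1 - arcParam z k w / s) : ℝ)

section ArcBump

variable {z : Circle} {k : ℤˣ} {s : ℝ} {G : ℝ → ℂ}

theorem norm_arcBump_le (hs : 0 < s) {C : ℝ} (hC : 0 ≤ C) (hG : ∀ u, ‖G u‖ ≤ C) (w : Circle) :
    ‖arcBump z k s G w‖ ≤ C := by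
  have h1 : max 0 (1 - arcParam z k w / s) ≤ 1 :=
    max_le zero_le_one (sub_le_self _ (div_pos (arcParam_pos _ _ _) hs).le)
  rw [arcBump, norm_mul, Complex.norm_real, Real.norm_of_nonneg (le_max_left _ _)]
  exact (mul_le_mul (hG _) h1 (le_max_left _ _) hC).trans_eq (mul_one C)

theorem continuousAt_arcBump (hG : Continuous G) {w : Circle} (hw : w ≠ z) :
    ContinuousAt (arcBump z k s G) w := by
  have h := continuousAt_arcParam k hw
  refine (hG.continuousAt.comp (h.log (arcParam_pos _ _ _).ne')).mul ?_
  exact Complex.continuous_ofReal.continuousAt.comp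
    (continuousAt_const.max (continuousAt_const.sub (h.div_const s)))

theorem measurable_arcBump (hG : Continuous G) : Measurable (arcBump z k s G) :=
  measurable_of_continuousOn_compl_singleton z fun _ hw =>
    (continuousAt_arcBump hG hw).continuousWithinAt

theorem tendsto_arcBump_sub (hG : IsAlmostPeriodic G) (t₀ : ℝ) (k : ℤˣ) :
    Tendsto (fun t => arcBump (Circle.exp t₀) k s G (arcPoint t₀ k t) - G (Real.log t))
      (𝓝[>] 0) (𝓝 0) := by
  obtain ⟨C, -, hC⟩ := hG.bounded
  have hc : Continuous fun t : ℝ => ((max 0 (1 - t / s) : ℝ) : ℂ) - 1 := by fun_prop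
  have h1 : Tendsto (fun t : ℝ => (((max 0 (1 - t / s) : ℝ) : ℂ) - 1) * G (Real.log t))
      (𝓝[>] 0) (𝓝 0) := by
    refine Tendsto.zero_mul_isBoundedUnder_le ?_
      (isBoundedUnder_of_eventually_le (a := C) (Eventually.of_forall fun _ => hC _))
    have := hc.tendsto 0
    simp only [zero_div, sub_zero, max_eq_right zero_le_one, Complex.ofReal_one, sub_self] at this
    exact this.mono_left nhdsWithin_le_nhds
  refine h1.congr' ?_
  filter_upwards [Ioo_mem_nhdsGT Real.two_pi_pos] with t ht
  rw [arcBump, arcParam_arcPoint t₀ k ht.1 ht.2.le]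
  ring

theorem tendsto_arcBump_neg (hs : 0 < s) (hs' : s ≤ 2 * Real.pi) (hG : IsAlmostPeriodic G)
    (t₀ : ℝ) (k : ℤˣ) :
    Tendsto (fun t => arcBump (Circle.exp t₀) k s G (arcPoint t₀ (-k) t)) (𝓝[>] 0) (𝓝 0) := by
  obtain ⟨C, -, hC⟩ := hG.bounded
  have hc : Continuous fun t : ℝ => ((max 0 (1 - (2 * Real.pi - t) / s) : ℝ) : ℂ) := by fun_prop
  have h1 : Tendsto (fun t : ℝ => ((max 0 (1 - (2 * Real.pi - t) / s) : ℝ) : ℂ) *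
      G (Real.log (2 * Real.pi - t))) (𝓝[>] 0) (𝓝 0) := by
    refine Tendsto.zero_mul_isBoundedUnder_le ?_
      (isBoundedUnder_of_eventually_le (a := C) (Eventually.of_forall fun _ => hC _))
    have := hc.tendsto 0
    rw [sub_zero, max_eq_left (sub_nonpos.2 ((one_le_div hs).2 hs')), Complex.ofReal_zero] at this
    exact this.mono_left nhdsWithin_le_nhds
  refine h1.congr' ?_
  filter_upwards [Ioo_mem_nhdsGT Real.two_pi_pos] with t ht
  rw [arcBump, arcParam_arcPoint_neg t₀ k ht.1.le ht.2]
  ring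

end ArcBump

/-- Every almost periodic function occurs as an almost periodic limit at a prescribed point
of `S` from a prescribed side. -/
theorem exists_AP_hasAPLimit {S : Set Circle} {z : Circle} (hz : z ∈ S) (k : ℤˣ) (G : APReal) :
    ∃ f : AP S, HasAPLimit f z k (G : ℝ →ᵇ ℂ) := by
  have hG := APReal.isAlmostPeriodic G
  obtain ⟨f, hf⟩ := LInfty.exists_of_bounded (measurable_arcBump (z := z) (k := k)
    (s := 2 * Real.pi) hG.1)
    (norm_arcBump_le Real.two_pi_pos (norm_nonneg G) (APReal.norm_coe_le G))
  have hk : ∀ t₀, Circle.exp t₀ = z → HasAPLimit f (Circle.exp t₀) k (G : ℝ →ᵇ ℂ) := by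
    rintro t₀ rfl
    exact .of_rep hf (tendsto_arcBump_sub hG t₀ k)
  refine ⟨⟨f, .of_hasAPLimit fun t₁ k' => ?_, _, hf, fun w hw =>
    (continuousAt_arcBump hG.1 (ne_of_mem_of_not_mem hz hw).symm).continuousWithinAt⟩, ?_⟩
  · by_cases h : Circle.exp t₁ = z
    · rcases eq_or_ne k' k with rfl | hne
      · exact ⟨_, hG, hk t₁ h⟩
      · obtain rfl : k' = -k := Int.units_ne_iff_eq_neg.1 hne
        refine ⟨_, .const 0, .of_rep hf ?_⟩
        subst h
        simpa using tendsto_arcBump_neg Real.two_pi_pos le_rfl hG t₁ k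
    · exact ⟨_, .const _, (HasOneSidedLimit.of_continuousAt hf
        (continuousAt_arcBump hG.1 h) k').hasAPLimit⟩
  · obtain ⟨t₀, ht₀⟩ := Circle.exp_surjective z
    have := hk t₀ ht₀
    rwa [ht₀] at this

/-- A function in `R_S` that is continuous off a given point of `S`, where it has the limits `1`
from the side `k` and `0` from the other side, and that is supported in a short arc. -/
theorem exists_Reg_bump {S : Set Circle} {z : Circle} (hz : z ∈ S) (k : ℤˣ) {s : ℝ} (hs : 0 < s)
    (hs' : s ≤ 2 * Real.pi) : ∃ e : Reg S,
      (∀ᵐ w ∂arcLength, ‖(e : LInfty) w‖ ≤ 1 ∧ (s ≤ arcParam z k w → (e : LInfty) w = 0)) ∧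
      ∀ t₀, Circle.exp t₀ = z → HasOneSidedLimit e t₀ k 1 ∧ HasOneSidedLimit e t₀ (-k) 0 := by
  have hG := IsAlmostPeriodic.const 1
  obtain ⟨f, hf⟩ := LInfty.exists_of_bounded (measurable_arcBump (z := z) (k := k)
    (s := s) hG.1) (norm_arcBump_le hs zero_le_one fun _ => norm_one.le)
  have hk : ∀ t₀, Circle.exp t₀ = z → HasOneSidedLimit f t₀ k 1 ∧ HasOneSidedLimit f t₀ (-k) 0 := by
    rintro t₀ rfl
    refine ⟨⟨_, hf, ?_⟩, ⟨_, hf, tendsto_arcBump_neg hs hs' hG t₀ k⟩⟩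
    simpa using (tendsto_arcBump_sub hG t₀ k).add_const 1
  refine ⟨⟨f, ⟨_, hf, fun w hw =>
    (continuousAt_arcBump hG.1 (ne_of_mem_of_not_mem hz hw).symm).continuousWithinAt⟩,
    fun t₁ _ k' => ?_⟩, ?_, hk⟩
  · by_cases h : Circle.exp t₁ = z
    · rcases eq_or_ne k' k with rfl | hne
      · exact ⟨_, (hk t₁ h).1⟩
      · obtain rfl : k' = -k := Int.units_ne_iff_eq_neg.1 hne
        exact ⟨_, (hk t₁ h).2⟩
    · exact ⟨_, .of_continuousAt hf (continuousAt_arcBump hG.1 h) k'⟩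
  · filter_upwards [hf] with w hw
    rw [hw]
    refine ⟨norm_arcBump_le hs zero_le_one (fun _ => norm_one.le) w, fun h => ?_⟩
    rw [arcBump, max_eq_left (sub_nonpos.2 ((one_le_div hs).2 h)), Complex.ofReal_zero, mul_zero]

/-! ### The fibres of `c_S` -/

theorem cMap_eq_iff {S : Set Circle} {χ : WeakDual.characterSpace ℂ (Reg S)} {z : Circle} :
    cMap S χ = z ↔ ∀ h : C(Circle, ℂ), χ (contToReg S h) = h z := by
  have h1 : cMap S χ = z ↔
      dualMap (contToReg S) χ = WeakDual.CharacterSpace.homeoEval Circle ℂ z :=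
    (WeakDual.CharacterSpace.homeoEval Circle ℂ).symm_apply_eq
  rw [h1]
  exact ⟨fun h f => DFunLike.congr_fun h f, fun h => WeakDual.CharacterSpace.ext h⟩

theorem contToReg_coeFn {S : Set Circle} (h : C(Circle, ℂ)) :
    ((contToReg S h : Reg S) : LInfty) =ᵐ[arcLength] h :=
  ContinuousMap.coeFn_toLp arcLength h

theorem apply_contToReg {S : Set Circle} (χ : WeakDual.characterSpace ℂ (Reg S))
    (h : C(Circle, ℂ)) : χ (contToReg S h) = h (cMap S χ) :=
  cMap_eq_iff.1 rfl h

/-- Evaluation at `0`, as a point of the Bohr compactification. -/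
def bohrZero : BohrCompactification :=
  charMk
    { toFun := fun G => (G : ℝ →ᵇ ℂ) 0
      map_one' := rfl
      map_mul' := fun _ _ => rfl
      map_zero' := rfl
      map_add' := fun _ _ => rfl
      commutes' := fun _ => rfl }
    fun G => APReal.norm_coe_le G 0

/-- The character of `R_S` that assigns to a function its limit at `z` from the side `k`. As it
is obtained through almost periodic limits, it is defined whether or not `z` lies in `S`. -/
def sideChar {S : Set Circle} (hS : IsClosed S) (z : Circle) (k : ℤˣ) :
    WeakDual.characterSpace ℂ (Reg S) :=
  rMap hS (dualMap (apLimit S z k) bohrZero)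

theorem rMap_dualMap_apLimit_apply {S : Set Circle} (hS : IsClosed S) {t₀ : ℝ} {k : ℤˣ}
    (ψ : BohrCompactification) {f : Reg S} {L : ℂ} (h : HasOneSidedLimit f t₀ k L) :
    rMap hS (dualMap (apLimit S (Circle.exp t₀) k) ψ) f = L := by
  have h1 : apLimit S (Circle.exp t₀) k (regToAP hS f) = algebraMap ℂ APReal L :=
    apLimit_eq_algebraMap h
  rw [rMap, dualMap_apply, dualMap_apply, h1, AlgHomClass.commutes, Algebra.algebraMap_self_apply]

theorem sideChar_apply {S : Set Circle} (hS : IsClosed S) {t₀ : ℝ} {k : ℤˣ} {f : Reg S} {L : ℂ}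
    (h : HasOneSidedLimit f t₀ k L) : sideChar hS (Circle.exp t₀) k f = L :=
  rMap_dualMap_apLimit_apply hS _ h

theorem hasOneSidedLimit_sideChar {S : Set Circle} (hS : IsClosed S) (t₀ : ℝ) (k : ℤˣ)
    (f : Reg S) : HasOneSidedLimit f t₀ k (sideChar hS (Circle.exp t₀) k f) := by
  obtain ⟨L, hL⟩ := Reg.exists_limit hS f.2 t₀ k
  rwa [sideChar_apply hS hL]

/-- All characters of `AP(S)` that factor through the almost periodic limit at a given point
from a given side lie over the same character of `R_S`. -/
theorem rMap_dualMap_apLimit {S : Set Circle} (hS : IsClosed S) (z : Circle) (k : ℤˣ)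
    (ψ : BohrCompactification) : rMap hS (dualMap (apLimit S z k) ψ) = sideChar hS z k := by
  obtain ⟨t₀, rfl⟩ := Circle.exp_surjective z
  exact WeakDual.CharacterSpace.ext fun f =>
    rMap_dualMap_apLimit_apply hS ψ (hasOneSidedLimit_sideChar hS t₀ k f)

theorem cMap_sideChar {S : Set Circle} (hS : IsClosed S) (z : Circle) (k : ℤˣ) :
    cMap S (sideChar hS z k) = z := by
  obtain ⟨t₀, rfl⟩ := Circle.exp_surjective z
  exact cMap_eq_iff.2 fun h => sideChar_apply hS
    (.of_continuousAt (contToReg_coeFn h) h.continuous.continuousAt k)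

theorem sideChar_ne {S : Set Circle} (hS : IsClosed S) {z : Circle} (hz : z ∈ S) :
    sideChar hS z 1 ≠ sideChar hS z (-1) := by
  obtain ⟨e, -, he⟩ := exists_Reg_bump hz 1 Real.two_pi_pos le_rfl
  obtain ⟨t₀, rfl⟩ := Circle.exp_surjective z
  intro h
  have h1 := sideChar_apply hS (he t₀ rfl).1
  rw [h, sideChar_apply hS (he t₀ rfl).2] at h1
  exact zero_ne_one h1

/-- A punctured neighbourhood of `z` consists of points close to `z` on one of the two sides. -/
theorem exists_forall_dist_lt_arcParam (z : Circle) {s : ℝ} (hs : 0 < s) : ∃ r > 0, ∀ w,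
    dist w z < r → w ≠ z → arcParam z 1 w < s ∨ arcParam z (-1) w < s := by
  obtain ⟨t₀, rfl⟩ := Circle.exp_surjective z
  have hc : Continuous (arcPoint t₀ 1) := by unfold arcPoint; fun_prop
  have hK : IsClosed (arcPoint t₀ 1 '' Icc s (2 * Real.pi - s)) :=
    (isCompact_Icc.image hc).isClosed
  have hz : Circle.exp t₀ ∉ arcPoint t₀ 1 '' Icc s (2 * Real.pi - s) := by
    rintro ⟨t, ht, h⟩
    have h1 := arcParam_arcPoint t₀ 1 (hs.trans_le ht.1) (by linarith [ht.2])
    rw [h, arcParam_self] at h1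
    linarith [ht.2]
  obtain ⟨r, hr, hball⟩ := Metric.isOpen_iff.1 hK.isOpen_compl _ hz
  refine ⟨r, hr, fun w hw hne => ?_⟩
  by_contra! hcon
  refine hball hw ⟨arcParam (Circle.exp t₀) 1 w, ⟨hcon.1, ?_⟩, arcPoint_arcParam t₀ 1 w⟩
  have h2 := arcParam_arcPoint_neg t₀ 1 (arcParam_pos (Circle.exp t₀) (-1) w).le (arcParam_lt _ hne)
  rw [arcPoint_arcParam] at h2
  linarith [hcon.2]

/-- A character over `z` annihilates the functions that tend to `0` at `z` from both sides:
multiplication with a continuous bump at `z` makes them small. -/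
theorem apply_eq_zero_of_hasOneSidedLimit_zero {S : Set Circle}
    (χ : WeakDual.characterSpace ℂ (Reg S)) {t₀ : ℝ} (hχ : cMap S χ = Circle.exp t₀) {f : Reg S}
    (hf : ∀ k, HasOneSidedLimit f t₀ k 0) : χ f = 0 := by
  rw [← norm_le_zero_iff]
  refine le_of_forall_pos_le_add fun ε hε => ?_
  rw [zero_add]
  have key : ∀ k : ℤˣ, ∃ s > 0, ∀ᵐ w ∂arcLength, arcParam (Circle.exp t₀) k w < s →
      ‖(f : LInfty) w‖ < ε := fun k => by
    obtain ⟨s, hs, h⟩ := eventually_sideFilter_exp_iff.1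
      (Metric.tendsto_nhds.1 (hf k).hasAPLimit ε hε)
    rw [ae_restrict_iff' (measurableSet_openArc t₀ k s),
      openArc_eq t₀ k (by linarith [hs.1, hs.2])] at h
    exact ⟨s, hs.1, by simpa using h⟩
  obtain ⟨s₁, hs₁, h₁⟩ := key 1
  obtain ⟨s₂, hs₂, h₂⟩ := key (-1)
  obtain ⟨r, hr, hdist⟩ := exists_forall_dist_lt_arcParam (Circle.exp t₀) (lt_min hs₁ hs₂)
  let b : C(Circle, ℂ) := ⟨fun w => (max 0 (1 - dist w (Circle.exp t₀) / r) : ℝ), by fun_prop⟩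
  have hb : b (Circle.exp t₀) = 1 := by simp [b]
  have h3 : χ (f * contToReg S b) = χ f := by
    rw [map_mul, apply_contToReg, hχ, hb, mul_one]
  rw [← h3]
  refine (WeakDual.CharacterSpace.norm_apply_le χ _).trans (LInfty.norm_le_of_ae hε.le ?_)
  have hne : ∀ᵐ w ∂arcLength, w ≠ Circle.exp t₀ :=
    compl_mem_ae_iff.2 (measure_singleton _)
  filter_upwards [LInfty.coeFn_mul f (contToReg S b), contToReg_coeFn (S := S) b, h₁, h₂, hne]
    with w e1 e2 e3 e4 e5
  change ‖((f : LInfty) * (contToReg S b : Reg S) : LInfty) w‖ ≤ ε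
  rw [e1, e2, norm_mul]
  have hbw : ‖b w‖ = max 0 (1 - dist w (Circle.exp t₀) / r) := by
    change ‖((max 0 (1 - dist w (Circle.exp t₀) / r) : ℝ) : ℂ)‖ = _
    rw [Complex.norm_real, Real.norm_of_nonneg (le_max_left _ _)]
  rw [hbw]
  rcases lt_or_ge (dist w (Circle.exp t₀)) r with hw | hw
  · have hfw : ‖(f : LInfty) w‖ < ε := by
      rcases hdist w hw e5 with h | h
      exacts [e3 (h.trans_le (min_le_left _ _)), e4 (h.trans_le (min_le_right _ _))]
    have hle : max 0 (1 - dist w (Circle.exp t₀) / r) ≤ 1 :=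
      max_le zero_le_one (sub_le_self _ (by positivity))
    exact (mul_le_mul hfw.le hle (le_max_left _ _) hε.le).trans_eq (mul_one ε)
  · rw [max_eq_left (sub_nonpos.2 ((one_le_div hr).2 hw)), mul_zero]
    exact hε.le

theorem eq_sideChar_of_cMap_eq {S : Set Circle} (hS : IsClosed S) {z : Circle} (hz : z ∈ S)
    {χ : WeakDual.characterSpace ℂ (Reg S)} (hχ : cMap S χ = z) :
    χ = sideChar hS z 1 ∨ χ = sideChar hS z (-1) := by
  obtain ⟨e, -, he⟩ := exists_Reg_bump hz 1 Real.two_pi_pos le_rfl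
  obtain ⟨t₀, rfl⟩ := Circle.exp_surjective z
  set p := sideChar hS (Circle.exp t₀) 1
  set m := sideChar hS (Circle.exp t₀) (-1)
  have hpe : p e = 1 := sideChar_apply hS (he t₀ rfl).1
  have hme : m e = 0 := sideChar_apply hS (he t₀ rfl).2
  -- modulo the common kernel of `p` and `m`, the function `f` equals `m f + (p f - m f) e`
  have key : ∀ f, χ f = m f + (p f - m f) * χ e := by
    intro f
    have h0 : ∀ k, HasOneSidedLimit (f - algebraMap ℂ (Reg S) (m f) -
        algebraMap ℂ (Reg S) (p f - m f) * e : Reg S) t₀ k 0 := by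
      intro k
      convert hasOneSidedLimit_sideChar hS t₀ k _ using 1
      rcases Int.units_eq_one_or k with rfl | rfl
      · change 0 = p _
        simp only [map_sub, map_mul, AlgHomClass.commutes, Algebra.algebraMap_self_apply, hpe]
        ring
      · change 0 = m _
        simp only [map_sub, map_mul, AlgHomClass.commutes, Algebra.algebraMap_self_apply, hme]
        ring
    have h1 := apply_eq_zero_of_hasOneSidedLimit_zero χ hχ h0
    simp only [map_sub, map_mul, AlgHomClass.commutes, Algebra.algebraMap_self_apply] at h1
    linear_combination h1
  -- `e` is idempotent modulo that kernel
  have h2 := key (e * e)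
  rw [map_mul, map_mul, map_mul, hpe, hme] at h2
  have h3 : χ e * (χ e - 1) = 0 := by linear_combination h2
  rcases mul_eq_zero.1 h3 with h4 | h4
  · right
    exact WeakDual.CharacterSpace.ext fun f => by rw [key, h4]; ring
  · left
    exact WeakDual.CharacterSpace.ext fun f => by rw [key, sub_eq_zero.1 h4]; ring

theorem exists_eq_sideChar {S : Set Circle} (hS : IsClosed S)
    {χ : WeakDual.characterSpace ℂ (Reg S)} (hχ : cMap S χ ∈ S) :
    ∃ k, χ = sideChar hS (cMap S χ) k :=
  (eq_sideChar_of_cMap_eq hS hχ rfl).elim (fun h => ⟨_, h⟩) fun h => ⟨_, h⟩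

/-! ### The maximal ideal spaces over the complement of `S` -/

theorem eqOn_of_ae_eq_of_isOpen {X : Type*} [TopologicalSpace X] [T2Space X] {g g' : Circle → X}
    {U : Set Circle} (hU : IsOpen U) (h : g =ᵐ[arcLength] g') (hg : ContinuousOn g U)
    (hg' : ContinuousOn g' U) : EqOn g g' U :=
  Measure.eqOn_open_of_ae_eq (ae_restrict_of_ae h) hU hg hg'

theorem norm_rep_le {f : LInfty} {g : Circle → ℂ} {U : Set Circle} (hU : IsOpen U)
    (hfg : f =ᵐ[arcLength] g) (hg : ContinuousOn g U) {w : Circle} (hw : w ∈ U) :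
    ‖g w‖ ≤ ‖f‖ := by
  have h : EqOn (fun w => max ‖g w‖ ‖f‖) (fun _ => ‖f‖) U := by
    refine eqOn_of_ae_eq_of_isOpen hU ?_ (hg.norm.sup continuousOn_const) continuousOn_const
    filter_upwards [hfg, LInfty.ae_norm_le f] with w h1 h2
    rw [← h1, max_eq_right h2]
  exact max_eq_right_iff.1 (h hw)

theorem contRep_unique {S : Set Circle} (hS : IsClosed S) {f : LInfty} (hf : HasContinuousRepOn f Sᶜ) {g : Circle → ℂ}
    (hfg : f =ᵐ[arcLength] g) (hg : ContinuousOn g Sᶜ) {z : Circle} (hz : z ∉ S) :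
    hf.choose z = g z :=
  eqOn_of_ae_eq_of_isOpen hS.isOpen_compl (hf.choose_spec.1.symm.trans hfg) hf.choose_spec.2 hg hz

section OffS

variable {S : Set Circle} {B : Subalgebra ℂ LInfty} (hS : IsClosed S)
  (hB : ∀ f ∈ B, HasContinuousRepOn f Sᶜ)

/-- Evaluation of the continuous representatives at a point off `S`, as a character of an algebra
of functions that are continuous off `S`. -/
def evalChar (z : (Sᶜ : Set Circle)) : WeakDual.characterSpace ℂ B :=
  have hspec (f : B) := (hB f f.2).choose_spec
  charMk
    { toFun := fun f => (hB f f.2).choose z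
      map_one' := contRep_unique hS _ LInfty.coeFn_one continuousOn_const z.2
      map_mul' := fun f g => contRep_unique hS _
        ((LInfty.coeFn_mul f g).trans ((hspec f).1.mul (hspec g).1))
        ((hspec f).2.mul (hspec g).2) z.2
      map_zero' := contRep_unique hS _ (Lp.coeFn_zero ℂ ∞ arcLength) continuousOn_const z.2
      map_add' := fun f g => contRep_unique hS _
        ((Lp.coeFn_add (f : LInfty) g).trans ((hspec f).1.add (hspec g).1))
        ((hspec f).2.add (hspec g).2) z.2
      commutes' := fun c => contRep_unique hS _ (LInfty.coeFn_algebraMap c)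
        continuousOn_const z.2 }
    fun f => norm_rep_le hS.isOpen_compl (hspec f).1 (hspec f).2 z.2

theorem evalChar_apply (z : (Sᶜ : Set Circle)) (f : B) {g : Circle → ℂ}
    (hfg : (f : LInfty) =ᵐ[arcLength] g) (hg : ContinuousOn g Sᶜ) :
    evalChar hS hB z f = g z :=
  contRep_unique hS _ hfg hg z.2

theorem continuous_evalChar : Continuous (evalChar hS hB) :=
  WeakDual.CharacterSpace.continuous_of_apply fun f => (hB f f.2).choose_spec.2.domRestrict

/-- A character of `B` that restricts on `C(∂𝔻)` to evaluation at a point `z` off `S` is itself the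
evaluation at `z`: the product of a function in `B` with the distance from `S` is continuous on the
whole circle. -/
theorem eq_evalChar (hne : S.Nonempty) (φ : C(Circle, ℂ) → B)
    (hφ : ∀ h, (φ h : LInfty) =ᵐ[arcLength] h) {χ : WeakDual.characterSpace ℂ B}
    (z : (Sᶜ : Set Circle)) (hχ : ∀ h, χ (φ h) = h z) : χ = evalChar hS hB z := by
  refine WeakDual.CharacterSpace.ext fun f => ?_
  obtain ⟨g, hfg, hg⟩ := hB f f.2
  rw [evalChar_apply hS hB z f hfg hg]
  let ρ : C(Circle, ℂ) := ⟨fun w => (Metric.infDist w S : ℝ), by fun_prop⟩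
  have hρ : ∀ w, ρ w = (Metric.infDist w S : ℝ) := fun _ => rfl
  have hρS : ∀ w ∈ S, ρ w = 0 := fun w hw => by
    rw [hρ, Metric.infDist_zero_of_mem hw, Complex.ofReal_zero]
  have hρz : ρ z ≠ 0 :=
    Complex.ofReal_ne_zero.2 ((hS.notMem_iff_infDist_pos hne).1 z.2).ne'
  have hcont : Continuous fun w => g w * ρ w := by
    rw [continuous_iff_continuousAt]
    intro w
    by_cases hw : w ∈ S
    · have hlim : Tendsto (fun w => ‖f‖ * ‖ρ w‖) (𝓝 w) (𝓝 0) := by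
        have : Continuous fun w => ‖f‖ * ‖ρ w‖ := by fun_prop
        simpa [hρS w hw] using this.tendsto w
      rw [ContinuousAt, hρS w hw, mul_zero]
      refine squeeze_zero_norm (fun w' => ?_) hlim
      by_cases hw' : w' ∈ S
      · simp [hρS w' hw']
      · rw [norm_mul]
        exact mul_le_mul_of_nonneg_right (norm_rep_le hS.isOpen_compl hfg hg hw') (norm_nonneg _)
    · exact (hg.continuousAt (hS.isOpen_compl.mem_nhds hw)).mul ρ.continuous.continuousAt
  have hmul : f * φ ρ = φ ⟨_, hcont⟩ := by
    refine Subtype.ext (Lp.ext ?_)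
    filter_upwards [LInfty.coeFn_mul f (φ ρ), hφ ρ, hφ ⟨_, hcont⟩, hfg] with w h1 h2 h3 h4
    rw [h3]
    refine h1.trans ?_
    rw [h2, h4]
    rfl
  have h1 := congrArg χ hmul
  rw [map_mul, hχ, hχ] at h1
  exact mul_right_cancel₀ hρz h1

end OffS

section OffSMaps

variable {S : Set Circle} (hS : IsClosed S)

/-- Evaluation of the functions in `R_S` at a point off `S`. -/
def regEval : (Sᶜ : Set Circle) → WeakDual.characterSpace ℂ (Reg S) :=
  evalChar hS fun _ hf => hf.1

/-- Evaluation of the functions in `AP(S)` at a point off `S`. -/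
def apEval : (Sᶜ : Set Circle) → WeakDual.characterSpace ℂ (AP S) :=
  evalChar hS fun _ hf => hf.2

theorem rMap_apEval (z : (Sᶜ : Set Circle)) : rMap hS (apEval hS z) = regEval hS z := rfl

theorem cMap_regEval (z : (Sᶜ : Set Circle)) : cMap S (regEval hS z) = z :=
  cMap_eq_iff.2 fun h => evalChar_apply hS _ z _ (contToReg_coeFn h) h.continuous.continuousOn

theorem eq_regEval (hne : S.Nonempty) (χ : WeakDual.characterSpace ℂ (Reg S))
    (hχ : cMap S χ ∈ Sᶜ) : χ = regEval hS ⟨cMap S χ, hχ⟩ :=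
  eq_evalChar hS _ hne (contToReg S) contToReg_coeFn _ (apply_contToReg χ)

theorem eq_apEval (hne : S.Nonempty) (χ : WeakDual.characterSpace ℂ (AP S))
    (hχ : cMap S (rMap hS χ) ∈ Sᶜ) : χ = apEval hS ⟨cMap S (rMap hS χ), hχ⟩ :=
  eq_evalChar hS _ hne (fun h => regToAP hS (contToReg S h))
    (contToReg_coeFn (S := S)) _
    (apply_contToReg (rMap hS χ))

theorem continuous_regEval : Continuous (regEval hS) := continuous_evalChar hS _

theorem continuous_apEval : Continuous (apEval hS) := continuous_evalChar hS _

end OffSMaps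

theorem isHomeomorph_cMap {S : Set Circle} (hS : IsClosed S) (hne : S.Nonempty) :
    IsHomeomorph (Sᶜ.restrictPreimage (cMap S)) := by
  have hmem (z : (Sᶜ : Set Circle)) : regEval hS z ∈ cMap S ⁻¹' Sᶜ := by
    rw [mem_preimage, cMap_regEval]
    exact z.2
  exact isHomeomorph_iff_exists_inverse.2 ⟨(cMap S).continuous.restrictPreimage,
    fun z => ⟨regEval hS z, hmem z⟩, fun χ => Subtype.ext (eq_regEval hS hne χ.1 χ.2).symm,
    fun z => Subtype.ext (cMap_regEval hS z), (continuous_regEval hS).subtype_mk _⟩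

theorem isHomeomorph_rMap {S : Set Circle} (hS : IsClosed S) (hne : S.Nonempty) :
    IsHomeomorph ((cMap S ⁻¹' S)ᶜ.restrictPreimage (rMap hS)) := by
  have hmem (z : (Sᶜ : Set Circle)) : apEval hS z ∈ rMap hS ⁻¹' (cMap S ⁻¹' S)ᶜ := by
    rw [mem_preimage, rMap_apEval, mem_compl_iff, mem_preimage, cMap_regEval]
    exact z.2
  exact isHomeomorph_iff_exists_inverse.2 ⟨(rMap hS).continuous.restrictPreimage,
    fun ξ => ⟨apEval hS ⟨cMap S ξ, ξ.2⟩, hmem _⟩,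
    fun χ => Subtype.ext (eq_apEval hS hne χ.1 χ.2).symm,
    fun ξ => Subtype.ext (eq_regEval hS hne ξ.1 ξ.2).symm,
    ((continuous_apEval hS).comp
      (((cMap S).continuous.comp continuous_subtype_val).subtype_mk _)).subtype_mk _⟩

/-! ### Total disconnectedness of the part over `S` -/

/-- The indicator function of an arc with both endpoints in `S` belongs to `R_S`. -/
theorem exists_Reg_indicator {S : Set Circle} (hS : IsClosed S) {v v' : Circle} (hv : v ∈ S)
    (hv' : v' ∈ S) (hne : v' ≠ v) : ∃ e : Reg S, e * e = e ∧ ∀ u, u ≠ v → u ≠ v' → ∀ k,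
      sideChar hS u k e = if arcParam v 1 u < arcParam v 1 v' then 1 else 0 := by
  obtain ⟨t₀, rfl⟩ := Circle.exp_surjective v
  set τ := arcParam (Circle.exp t₀) 1
  have hs0 : 0 < τ v' := arcParam_pos _ _ _
  have hs1 : τ v' < 2 * Real.pi := arcParam_lt 1 hne
  set g : Circle → ℂ := fun u => if τ u < τ v' then 1 else 0 with hg
  have hcont : ∀ u, u ≠ Circle.exp t₀ → u ≠ v' → ContinuousAt g u := by
    intro u hu hu'
    have hc : ContinuousAt τ u := continuousAt_arcParam 1 hu
    rcases lt_or_gt_of_ne ((arcParam_injective _ _).ne hu' : τ u ≠ τ v') with h | h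
    · refine (continuousAt_const (y := (1 : ℂ))).congr ?_
      filter_upwards [hc.eventually (gt_mem_nhds h)] with w hw
      exact (if_pos hw).symm
    · refine (continuousAt_const (y := (0 : ℂ))).congr ?_
      filter_upwards [hc.eventually (lt_mem_nhds h)] with w hw
      exact (if_neg hw.le.not_gt).symm
  obtain ⟨f, hf⟩ := LInfty.exists_of_bounded (g := g) (C := 1)
    (Measurable.ite (isOpen_arcParam_lt _ 1 hs1.le).measurableSet measurable_const
      measurable_const) (fun w => by rw [hg]; beta_reduce; split_ifs <;> simp)
  have hlim : ∀ t₁, ∀ k, ∃ L, HasOneSidedLimit f t₁ k L := by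
    intro t₁ k
    by_cases h0 : Circle.exp t₁ = Circle.exp t₀
    · have harc : arcPoint t₁ k = arcPoint t₀ k := by
        funext t; rw [arcPoint_eq, arcPoint_eq, h0]
      rcases Int.units_eq_one_or k with rfl | rfl
      · refine ⟨1, g, hf, tendsto_const_nhds.congr' ?_⟩
        filter_upwards [Ioo_mem_nhdsGT hs0] with t ht
        have : τ (arcPoint t₀ 1 t) = t := arcParam_arcPoint t₀ 1 ht.1 (ht.2.trans hs1).le
        rw [harc, hg]; beta_reduce
        rw [this, if_pos ht.2]
      · refine ⟨0, g, hf, tendsto_const_nhds.congr' ?_⟩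
        filter_upwards [Ioo_mem_nhdsGT (sub_pos.2 hs1)] with t ht
        have : τ (arcPoint t₀ (-1) t) = 2 * Real.pi - t :=
          arcParam_arcPoint_neg t₀ 1 ht.1.le (by linarith [ht.2])
        rw [harc, hg]; beta_reduce
        rw [this, if_neg (by linarith [ht.2])]
    by_cases h1 : Circle.exp t₁ = v'
    · have harc : ∀ t, arcPoint t₁ k t = arcPoint t₀ 1 (τ v' + ((k : ℤ) : ℝ) * t) := by
        intro t
        rw [arcPoint_eq, arcPoint_eq, h1, Circle.exp_add, Circle.exp_intCast_mul, exp_arcParam,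
          Units.val_one, zpow_one, zpow_one, ← mul_assoc, mul_div_cancel]
      rcases Int.units_eq_one_or k with rfl | rfl
      · refine ⟨0, g, hf, tendsto_const_nhds.congr' ?_⟩
        filter_upwards [Ioo_mem_nhdsGT (sub_pos.2 hs1)] with t ht
        have : τ (arcPoint t₁ 1 t) = τ v' + t := by
          rw [harc, Units.val_one, Int.cast_one, one_mul]
          exact arcParam_arcPoint t₀ 1 (by linarith [ht.1]) (by linarith [ht.2])
        rw [hg]; beta_reduce
        rw [this, if_neg (by linarith [ht.1])]
      · refine ⟨1, g, hf, tendsto_const_nhds.congr' ?_⟩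
        filter_upwards [Ioo_mem_nhdsGT hs0] with t ht
        have : τ (arcPoint t₁ (-1) t) = τ v' - t := by
          rw [harc, Units.val_neg, Units.val_one, Int.cast_neg, Int.cast_one, neg_one_mul,
            ← sub_eq_add_neg]
          exact arcParam_arcPoint t₀ 1 (by linarith [ht.2]) (by linarith [ht.1])
        rw [hg]; beta_reduce
        rw [this, if_pos (by linarith [ht.1])]
    exact ⟨_, .of_continuousAt hf (hcont _ h0 h1) k⟩
  refine ⟨⟨f, ⟨g, hf, fun u hu => (hcont u (ne_of_mem_of_not_mem hv hu).symm
    (ne_of_mem_of_not_mem hv' hu).symm).continuousWithinAt⟩, fun t₁ _ k => hlim t₁ k⟩, ?_, ?_⟩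
  · refine Subtype.ext (Lp.ext ((LInfty.coeFn_mul f f).trans ?_))
    filter_upwards [hf] with w hw
    rw [hw, hg]; beta_reduce
    split_ifs <;> simp
  · intro u hu hu' k
    obtain ⟨t₁, rfl⟩ := Circle.exp_surjective u
    exact sideChar_apply hS (.of_continuousAt hf (hcont _ hu hu') k)

/-- A preconnected set over `S` with more than one point would have infinite image in `S`. A
point `v` of that image and the middle one of three further points, ordered by their distance from
`v`, are the endpoints of an arc whose indicator function is not constant on the set. -/
theorem isTotallyDisconnected_preimage_cMap {S : Set Circle} (hS : IsClosed S) :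
    IsTotallyDisconnected (cMap S ⁻¹' S) := by
  intro t htS ht
  by_contra hsub
  have hinf := ht.infinite_of_nontrivial (not_subsingleton_iff.1 hsub)
  have hAinf : (cMap S '' t).Infinite := by
    refine (ht.image _ (cMap S).continuous.continuousOn).infinite_of_nontrivial ?_
    by_contra hA
    rw [not_nontrivial_iff] at hA
    obtain ⟨χ, hχ⟩ := hinf.nonempty
    refine hinf ((toFinite {sideChar hS (cMap S χ) 1, sideChar hS (cMap S χ) (-1)}).subset
      fun η hη => ?_)
    exact eq_sideChar_of_cMap_eq hS (htS hχ)
      (hA (mem_image_of_mem _ hη) (mem_image_of_mem _ hχ))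
  obtain ⟨v, hv⟩ := hAinf.nonempty
  obtain ⟨F, hF, hcard⟩ := ((hAinf.sdiff (finite_singleton v)).image
    (arcParam_injective v 1).injOn).exists_subset_card_eq 3
  let x := F.orderEmbOfFin hcard
  have hx : ∀ i, ∃ χ ∈ t, cMap S χ ≠ v ∧ arcParam v 1 (cMap S χ) = x i := fun i => by
    obtain ⟨_, ⟨⟨χ, hχ, rfl⟩, hne⟩, hw⟩ := hF (F.orderEmbOfFin_mem hcard i)
    exact ⟨χ, hχ, hne, hw⟩
  choose χ hχ hne hτ using hx
  have hvS : v ∈ S := by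
    obtain ⟨η, hη, rfl⟩ := hv
    exact htS hη
  obtain ⟨e, hee, he⟩ := exists_Reg_indicator hS hvS (htS (hχ 1)) (hne 1)
  have hval : ∀ i, i ≠ 1 → χ i e = if x i < x 1 then 1 else 0 := fun i hi => by
    obtain ⟨k, hk⟩ := exists_eq_sideChar hS (htS (hχ i))
    rw [hk, he _ (hne i) (fun h => hi (x.injective (by rw [← hτ, ← hτ, h]))), hτ, hτ]
  have hcont : Continuous fun η : WeakDual.characterSpace ℂ (Reg S) => η e :=
    (WeakDual.eval_continuous e).comp continuous_subtype_val
  have hfin : ((fun η : WeakDual.characterSpace ℂ (Reg S) => η e) '' t).Finite := by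
    refine (toFinite {(0 : ℂ), 1}).subset ?_
    rintro _ ⟨η, -, rfl⟩
    have h1 : η e * (η e - 1) = 0 := by
      rw [mul_sub, mul_one, ← map_mul, hee, sub_self]
    exact (mul_eq_zero.1 h1).imp id sub_eq_zero.1
  refine (ht.image _ hcont.continuousOn).infinite_of_nontrivial
    ⟨_, mem_image_of_mem _ (hχ 0), _, mem_image_of_mem _ (hχ 2), ?_⟩ hfin
  rw [hval 0 (by decide), hval 2 (by decide), if_pos (x.strictMono (by decide)),
    if_neg (x.strictMono (by decide)).not_gt]
  exact one_ne_zero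

/-! ### The fibres of `r_S` over `S` -/

/-- A character of `AP(S)` over a one-sided limit at a point of `S` depends only on the almost
periodic limit from that side: multiplication with a bump supported near `z` on the side `k` makes
a function with zero almost periodic limit small. -/
theorem apply_eq_zero_of_apLimit_eq_zero {S : Set Circle} (hS : IsClosed S) {z : Circle}
    (hz : z ∈ S) {k : ℤˣ} {χ : WeakDual.characterSpace ℂ (AP S)}
    (hχ : rMap hS χ = sideChar hS z k) {f : AP S} (hf : apLimit S z k f = 0) : χ f = 0 := by
  obtain ⟨t₀, rfl⟩ := Circle.exp_surjective z
  rw [← norm_le_zero_iff]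
  refine le_of_forall_pos_le_add fun ε hε => ?_
  rw [zero_add]
  have hlim := hasAPLimit_apLimit (Circle.exp t₀) k f
  rw [hf] at hlim
  obtain ⟨s, hs, h⟩ := eventually_sideFilter_exp_iff.1 (Metric.tendsto_nhds.1 hlim ε hε)
  have hs2 : s ≤ 2 * Real.pi := by linarith [hs.1, hs.2]
  rw [ae_restrict_iff' (measurableSet_openArc t₀ k s), openArc_eq t₀ k hs2] at h
  obtain ⟨e, he, helim⟩ := exists_Reg_bump hz k hs.1 hs2
  have h1 : χ (regToAP hS e) = 1 := by
    change rMap hS χ e = 1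
    rw [hχ]
    exact sideChar_apply hS (helim t₀ rfl).1
  have h2 : χ (f * regToAP hS e) = χ f := by rw [map_mul, h1, mul_one]
  rw [← h2]
  refine (WeakDual.CharacterSpace.norm_apply_le χ _).trans (LInfty.norm_le_of_ae hε.le ?_)
  filter_upwards [LInfty.coeFn_mul f e, h, he] with w e1 e2 e3
  change ‖((f : LInfty) * (e : LInfty) : LInfty) w‖ ≤ ε
  rw [e1, norm_mul]
  rcases lt_or_ge (arcParam (Circle.exp t₀) k w) s with hw | hw
  · have hfw : ‖(f : LInfty) w‖ < ε := by simpa using e2 hw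
    exact (mul_le_mul hfw.le e3.1 (norm_nonneg _) hε.le).trans_eq (mul_one ε)
  · rw [e3.2 hw, norm_zero, mul_zero]
    exact hε.le

theorem apLimit_surjective {S : Set Circle} {z : Circle} (hz : z ∈ S) (k : ℤˣ) :
    Function.Surjective (apLimit S z k) := fun G =>
  (exists_AP_hasAPLimit hz k G).imp fun _ hf => apLimit_eq hf

theorem nonempty_fibre_homeomorph {S : Set Circle} (hS : IsClosed S) {z : Circle} (hz : z ∈ S)
    (k : ℤˣ) : Nonempty ((rMap hS ⁻¹' {sideChar hS z k} :
      Set (WeakDual.characterSpace ℂ (AP S))) ≃ₜ BohrCompactification) := by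
  have hsurj := apLimit_surjective hz k
  let Φ : BohrCompactification → (rMap hS ⁻¹' {sideChar hS z k} :
      Set (WeakDual.characterSpace ℂ (AP S))) :=
    fun ψ => ⟨dualMap (apLimit S z k) ψ, rMap_dualMap_apLimit hS z k ψ⟩
  have hΦ : Continuous Φ := (dualMap (apLimit S z k)).continuous.subtype_mk _
  have hbij : Function.Bijective Φ := by
    refine ⟨fun ψ ψ' h => WeakDual.CharacterSpace.ext fun G => ?_, fun ⟨χ, hχ⟩ => ?_⟩
    · obtain ⟨f, rfl⟩ := hsurj G
      exact DFunLike.congr_fun (congrArg Subtype.val h) f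
    · have hker : RingHom.ker (apLimit S z k).toAlgHom ≤
          RingHom.ker (WeakDual.CharacterSpace.toAlgHom χ) := fun f hf =>
        apply_eq_zero_of_apLimit_eq_zero hS hz hχ hf
      refine ⟨WeakDual.CharacterSpace.equivAlgHom.symm
        (AlgHom.liftOfSurjective (apLimit S z k).toAlgHom hsurj _ hker),
        Subtype.ext (WeakDual.CharacterSpace.ext fun f => ?_)⟩
      exact AlgHom.liftOfSurjective_apply (apLimit S z k).toAlgHom hsurj _ hker f
  exact ⟨(Continuous.homeoOfEquivCompactToT2 (f := Equiv.ofBijective Φ hbij) hΦ).symm⟩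

end

theorem mainTheorem3 (S : Set Circle) (hne : S.Nonempty) (hS : IsClosed S) :
    -- (1)
    (∀ z ∈ S, ∃ zp zm : WeakDual.characterSpace ℂ (Reg S), zp ≠ zm ∧
      cMap S ⁻¹' {z} = {zp, zm} ∧
      ∀ (f : Reg S) (t₀ : ℝ), Circle.exp t₀ = z →
        HasOneSidedLimit f t₀ 1 (zp f) ∧ HasOneSidedLimit f t₀ (-1) (zm f)) ∧
    -- (2)
    IsHomeomorph (Sᶜ.restrictPreimage (cMap S)) ∧
    -- (3)
    (IsTotallyDisconnected (cMap S ⁻¹' S) ∧ IsCompact (cMap S ⁻¹' S) ∧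
      T2Space (cMap S ⁻¹' S : Set (WeakDual.characterSpace ℂ (Reg S)))) ∧
    -- (4)
    (∀ ξ ∈ cMap S ⁻¹' S, Nonempty ((rMap hS ⁻¹' {ξ} : Set (WeakDual.characterSpace ℂ (AP S))) ≃ₜ
      BohrCompactification)) ∧
    -- (5)
    IsHomeomorph ((cMap S ⁻¹' S)ᶜ.restrictPreimage (rMap hS)) := by
  refine ⟨fun z hz => ?_, isHomeomorph_cMap hS hne,
    ⟨isTotallyDisconnected_preimage_cMap hS, ?_, inferInstance⟩, fun ξ hξ => ?_,
    isHomeomorph_rMap hS hne⟩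
  · refine ⟨sideChar hS z 1, sideChar hS z (-1), sideChar_ne hS hz, ?_, ?_⟩
    · refine Subset.antisymm (fun χ hχ => eq_sideChar_of_cMap_eq hS hz hχ) ?_
      rintro _ (rfl | rfl)
      exacts [cMap_sideChar hS z 1, cMap_sideChar hS z (-1)]
    · rintro f t₀ rfl
      exact ⟨hasOneSidedLimit_sideChar hS t₀ 1 f, hasOneSidedLimit_sideChar hS t₀ (-1) f⟩
  · have : CompactSpace (WeakDual.characterSpace ℂ (Reg S)) :=
      isCompact_iff_compactSpace.1 WeakDual.CharacterSpace.isCompact_characterSpace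
    exact (hS.preimage (cMap S).continuous).isCompact
  · obtain ⟨k, hk⟩ := exists_eq_sideChar hS hξ
    rw [hk]
    exact nonempty_fibre_homeomorph hS hξ k
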